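/- Let $\mathcal{M}=(S,\mathit{Act},P,\mathsf{init})$ be a Markov decision process with finite sets $S$ of states and $\mathit{Act}$ of actions, i.e. $P:S\times\mathit{Act}\times S\to[0,1]$ with $\sum_{t}P(s,\alpha,t)\in\{0,1\}$ for all $s,\alpha$; the action $\alpha$ is enabled in $s$ if this sum is $1$, and a state is terminal if no action is enabled in it. A scheduler maps each finite path that ends in a non-terminal state $s$ to a probability distribution over the actions enabled in $s$; $\mathrm{Pr}^{\mathfrak S}_{\mathcal M,s}$ is the induced probability measure on maximal paths from $s$, $\mathrm{Pr}^{\mathfrak S}_{\mathcal M}=\mathrm{Pr}^{\mathfrak S}_{\mathcal M,\mathsf{init}}$, and $\mathrm{Pr}^{\max}$, $\mathrm{Pr}^{\min}$ denote the supremum and infimum over all schedulers. As usual, $X\,\mathrm{U}\,T$ is the set of maximal paths that visit $T$ and all of whose states before some visit to $T$ lie in $X$, and $\Diamond T=S\,\mathrm{U}\,T$. Let $\mathsf{Eff}\subseteq S\setminus\{\mathsf{init}\}$ be a nonempty set of terminal states and $\mathsf{Cause}\subseteq S\setminus\mathsf{Eff}$ a nonempty set with $\mathrm{Pr}^{\max}_{\mathcal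 M}((\neg\mathsf{Cause})\,\mathrm{U}\,c)>0$ for all $c\in\mathsf{Cause}$. Such a set $\mathsf{Cause}$ is a GPR cause for $\mathsf{Eff}$ in $\mathcal M$ if every scheduler $\mathfrak S$ with $\mathrm{Pr}^{\mathfrak S}_{\mathcal M}(\Diamond\mathsf{Cause})>0$ satisfies $$\mathrm{Pr}^{\mathfrak S}_{\mathcal M}(\Diamond\mathsf{Eff}\mid\Diamond\mathsf{Cause})>\mathrm{Pr}^{\mathfrak S}_{\mathcal M}(\Diamond\mathsf{Eff}).\tag{GPR}$$ A scheduler $\mathfrak S$ refutes the GPR condition if $\mathrm{Pr}^{\mathfrak S}_{\mathcal M}(\Diamond\mathsf{Cause})>0$ and (GPR) fails for $\mathfrak S$; likewise for other MDPs. Let $\mathcal M_{[\mathsf{Cause}]}$ be the MDP resulting from $\mathcal M$ by removing all actions and transitions of the states in $\mathsf{Cause}$ and adding a fresh action $\gamma$, enabled exactly in the states $c\in\mathsf{Cause}$, with $P(c,\gamma,\mathsf{eff})=\mathrm{Pr}^{\min}_{\mathcal M,c}(\Diamond\mathsf{Eff})$ and $P(c,\gamma,\mathsf{noeff})=1-\mathrm{Pr}^{\min}_{\mathcal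 M,c}(\Diamond\mathsf{Eff})$, where $\mathsf{eff}$ is any fixed state in $\mathsf{Eff}$ and $\mathsf{noeff}$ is either a fresh terminal state or any fixed terminal state of $\mathcal M$ outside $\mathsf{Eff}\cup\mathsf{Cause}$. If $\mathsf{Cause}$ is not a GPR cause for $\mathsf{Eff}$ in $\mathcal M$, then 1. there is a memoryless randomized scheduler for $\mathcal M_{[\mathsf{Cause}]}$ (one whose choice depends on the last state of the path only) that refutes the GPR condition for $\mathsf{Cause}$ and $\mathsf{Eff}$ in $\mathcal M_{[\mathsf{Cause}]}$, and 2. there is a finite-memory randomized scheduler for $\mathcal M$ with two memory cells (the choice depends on the last state and on the current mode of a deterministic two-state automaton that reads the earlier states of the path) that refutes the GPR condition for $\mathsf{Cause}$ and $\mathsf{Eff}$ in $\mathcal M$. -/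

import Mathlib

open MeasureTheory ProbabilityTheory
open scoped NNReal ENNReal

/-- A Markov decision process with finite state space `S`: transition probabilities whose
sum over the successor states is `0` or `1` for every state and action, and an initial state. -/
structure MDP (S Act : Type*) [Fintype S] where
  P : S → Act → S → ℝ≥0
  init : S
  sum_P : ∀ s α, ∑ t, P s α t = 0 ∨ ∑ t, P s α t = 1

/-- Finite alternating sequences `s₀ α₀ s₁ α₁ … sₙ`: the list `(s₀, α₀), …, (sₙ₋₁, αₙ₋₁)` in
chronological order, and the last state `sₙ`. -/
@[ext]
structure FinPath (S Act : Type*) where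
  hist : List (S × Act)
  last : S

namespace FinPath

variable {S Act : Type*}

instance : MeasurableSpace (FinPath S Act) := ⊤

/-- The path consisting of the single state `s`. -/
def start (s : S) : FinPath S Act := ⟨[], s⟩

/-- The path `π` prolonged by the action `α` and the state `t`. -/
def extend (π : FinPath S Act) (α : Act) (t : S) : FinPath S Act :=
  ⟨π.hist ++ [(π.last, α)], t⟩

end FinPath

/-- The path property `X U T`, as an event on sequences of finite paths (in the sequences of
interest the `n`-th entry is the prefix with `n` steps of one maximal path, and a
finite maximal path is repeated forever). -/
def untilEvent {S : Type*} (Act : Type*) (X T : Set S) : Set (ℕ → FinPath S Act) :=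
  {ω | ∃ j, (∀ i < j, (ω i).last ∈ X) ∧ (ω j).last ∈ T}

/-- The path property `◇ T`. -/
def eventually {S : Type*} (Act : Type*) (T : Set S) : Set (ℕ → FinPath S Act) :=
  untilEvent Act Set.univ T

namespace MDP

variable {S Act : Type*} [Fintype S]

/-- The action `α` is enabled in `s`. -/
def Enabled (M : MDP S Act) (s : S) (α : Act) : Prop := ∑ t, M.P s α t = 1

/-- The set `Act(s)` of enabled actions, as a type. -/
abbrev EnabledAct (M : MDP S Act) (s : S) : Type _ := {α : Act // M.Enabled s α}

/-- A state is terminal if no action is enabled in it. -/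
def IsTerminal (M : MDP S Act) (s : S) : Prop := ∀ α, ¬ M.Enabled s α

/-- The distribution of the successor state when the enabled action `α` is taken in `s`. -/
noncomputable def next (M : MDP S Act) (s : S) (α : M.EnabledAct s) : PMF S :=
  PMF.ofFintype (fun t => (M.P s α.1 t : ℝ≥0∞)) (by
    have h : ∑ t, M.P s α.1 t = 1 := α.2
    exact_mod_cast h)

/-- A (randomized, history-dependent) scheduler: it maps finite paths with a non-terminal last
state to a distribution over the actions enabled in that state. -/
structure Scheduler (M : MDP S Act) where
  choice : (π : FinPath S Act) → ¬ M.IsTerminal π.last → PMF (M.EnabledAct π.last)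

instance (M : MDP S Act) : Nonempty M.Scheduler := by
  classical
  refine ⟨⟨fun π h => ?_⟩⟩
  have h' : ∃ α, M.Enabled π.last α := by
    simpa [IsTerminal] using h
  exact PMF.pure ⟨h'.choose, h'.choose_spec⟩

/-- Memoryless randomized (MR) schedulers: the distribution depends on the last state only. -/
def Scheduler.IsMemoryless {M : MDP S Act} (𝔖 : M.Scheduler) : Prop :=
  ∃ σ : (s : S) → ¬ M.IsTerminal s → PMF (M.EnabledAct s),
    ∀ (π : FinPath S Act) (h : ¬ M.IsTerminal π.last), 𝔖.choice π h = σ π.last h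

/-- Finite-memory (randomized) schedulers with `k` memory cells: a deterministic automaton with
`k` modes reads the states of the path before the last one, and the distribution depends on the
mode that is reached and on the last state. -/
def Scheduler.HasMemory {M : MDP S Act} (𝔖 : M.Scheduler) (k : ℕ) : Prop :=
  ∃ (q₀ : Fin k) (update : Fin k → S → Fin k)
    (σ : Fin k → (s : S) → ¬ M.IsTerminal s → PMF (M.EnabledAct s)),
    ∀ (π : FinPath S Act) (h : ¬ M.IsTerminal π.last),
      𝔖.choice π h = σ (π.hist.foldl (fun q x => update q x.1) q₀) π.last h

open Classical in
/-- One step of the Markov chain induced by a scheduler, whose states are finite paths.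
Paths that end in a terminal state are kept. -/
noncomputable def step (M : MDP S Act) (𝔖 : M.Scheduler) (π : FinPath S Act) :
    PMF (FinPath S Act) :=
  if h : M.IsTerminal π.last then PMF.pure π
  else (𝔖.choice π h).bind fun α => (M.next π.last α).map fun t => π.extend α.1 t

/-- The transition kernel of the induced Markov chain. -/
noncomputable def stepKernel (M : MDP S Act) (𝔖 : M.Scheduler) :
    Kernel (FinPath S Act) (FinPath S Act) where
  toFun π := (M.step 𝔖 π).toMeasure
  measurable' := measurable_from_top

instance (M : MDP S Act) (𝔖 : M.Scheduler) : IsMarkovKernel (M.stepKernel 𝔖) :=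
  ⟨fun π => inferInstanceAs (IsProbabilityMeasure (M.step 𝔖 π).toMeasure)⟩

/-- The probability measure of the Markov chain induced by `𝔖` when started in `s`. -/
noncomputable def Pr (M : MDP S Act) (𝔖 : M.Scheduler) (s : S) : Measure (ℕ → FinPath S Act) :=
  Kernel.traj (X := fun _ => FinPath S Act)
    (fun n => (M.stepKernel 𝔖).comap (fun x : (Π _ : Finset.Iic n, FinPath S Act) =>
      x ⟨n, Finset.mem_Iic.2 le_rfl⟩) (measurable_pi_apply _))
    0 (fun _ => FinPath.start s)

instance (M : MDP S Act) (𝔖 : M.Scheduler) (s : S) : IsProbabilityMeasure (M.Pr 𝔖 s) := by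
  unfold Pr; infer_instance

/-- The maximal (supremal) probability of an event over all schedulers. -/
noncomputable def prMax (M : MDP S Act) (s : S) (E : Set (ℕ → FinPath S Act)) : ℝ≥0∞ :=
  ⨆ 𝔖 : M.Scheduler, M.Pr 𝔖 s E

/-- The minimal (infimal) probability of an event over all schedulers. -/
noncomputable def prMin (M : MDP S Act) (s : S) (E : Set (ℕ → FinPath S Act)) : ℝ≥0∞ :=
  ⨅ 𝔖 : M.Scheduler, M.Pr 𝔖 s E

theorem prMin_le_one (M : MDP S Act) (s : S) (E : Set (ℕ → FinPath S Act)) :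
    M.prMin s E ≤ 1 :=
  (iInf_le _ (Classical.arbitrary M.Scheduler)).trans prob_le_one

/-- The probability-raising inequality `Pr(◇ Eff | ◇ Cause) > Pr(◇ Eff)` under `𝔖`. -/
def Raises (M : MDP S Act) (Eff Cause : Set S) (𝔖 : M.Scheduler) : Prop :=
  ProbabilityTheory.cond (M.Pr 𝔖 M.init) (eventually Act Cause) (eventually Act Eff)
    > M.Pr 𝔖 M.init (eventually Act Eff)

/-- The minimality condition: every state of `Cause` can be reached from the initial state
without visiting other states of `Cause` before. -/
def Minimality (M : MDP S Act) (Cause : Set S) : Prop :=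
  ∀ c ∈ Cause, 0 < M.prMax M.init (untilEvent Act Causeᶜ {c})

/-- `Cause` is a global probability-raising cause for `Eff`. -/
def IsGPRCause (M : MDP S Act) (Eff Cause : Set S) : Prop :=
  Cause.Nonempty ∧ Disjoint Cause Eff ∧ M.Minimality Cause ∧
    ∀ 𝔖 : M.Scheduler, 0 < M.Pr 𝔖 M.init (eventually Act Cause) → M.Raises Eff Cause 𝔖

/-- `𝔖` refutes the GPR condition: it reaches `Cause` with positive probability and violates
the probability-raising inequality. -/
def RefutesGPR (M : MDP S Act) (Eff Cause : Set S) (𝔖 : M.Scheduler) : Prop :=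
  0 < M.Pr 𝔖 M.init (eventually Act Cause) ∧ ¬ M.Raises Eff Cause 𝔖

open Classical in
/-- Transition probabilities of the MDP with minimal effect probabilities from `C`. -/
noncomputable def minEffectP (M : MDP S Act) (Eff C : Set S) (eff : S) (noeff : Option S) :
    Option S → Option Act → Option S → ℝ≥0
  | some s, some α, some t => if s ∈ C then 0 else M.P s α t
  | some s, none, t =>
      if s ∈ C then
        (if t = some eff then (M.prMin s (eventually Act Eff)).toNNReal else 0)
          + (if t = noeff then 1 - (M.prMin s (eventually Act Eff)).toNNReal else 0)
      else 0
  | _, _, _ => 0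

/-- The MDP resulting from `M` by removing the actions of the states in `C` and giving them
instead the fresh action `γ` (the action `none`), which leads from `c ∈ C` to the state `eff` with
probability `Pr^min_{M,c}(◇ Eff)` and to the state `noeff` otherwise. Here `noeff` is either a
state of `M` or a fresh terminal state (the state `none`; it is isolated if it is not used). -/
noncomputable def minEffect (M : MDP S Act) (Eff C : Set S) (eff : S) (noeff : Option S) :
    MDP (Option S) (Option Act) where
  P := M.minEffectP Eff C eff noeff
  init := some M.init
  sum_P := by
    classical
    intro s α
    have hw : ∀ c, (M.prMin c (eventually Act Eff)).toNNReal ≤ 1 := fun c => by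
      have := ENNReal.toNNReal_mono ENNReal.one_ne_top (M.prMin_le_one c (eventually Act Eff))
      simpa using this
    rcases s with _ | s
    · left
      exact Finset.sum_eq_zero fun t _ => by simp [minEffectP]
    · rcases α with _ | α
      · by_cases h : s ∈ C
        · right
          simp only [minEffectP, h, if_true, Finset.sum_add_distrib, Finset.sum_ite_eq',
            Finset.mem_univ]
          exact add_tsub_cancel_of_le (hw s)
        · left
          exact Finset.sum_eq_zero fun t _ => by simp [minEffectP, h]
      · by_cases h : s ∈ C
        · left
          exact Finset.sum_eq_zero fun t _ => by cases t <;> simp [minEffectP, h]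
        · simpa [Fintype.sum_option, minEffectP, h] using M.sum_P s α

end MDP

/-! Stop every path at its first visit to `T = Cause ∪ Eff`, and let `β` be a limit of the state
distributions of the stopped process. Three linear functionals of `β` matter: the mass `p` on
`Cause`, the mass `u` on `Eff`, and `w = ∑ c, β c * m c` over `Cause`, with `m` the minimal effect
probability. If `j` is the probability of visiting both sets, a scheduler refutes GPR iff `p > 0`
and `(1 - p) * j ≤ p * u`. Since `p ≤ 1`, this survives lowering `j` to `w`. So it is enough to find
one memoryless choice before `T` with `w ≤ p * (u + w)` (`Refuting`). The action `γ` then realizes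
`w` in the modified MDP, and in `M` a second memory cell records that `Cause` was visited and
switches to a minimizing scheduler.

To find this choice, pass from schedulers to flows. Expected state-action counts `y` up to time `n`
satisfy `distribution = δ_init + netFlow y`. The counts may diverge, but net flows form a finitely
generated, hence closed, cone, so a limit `β` still belongs to a finite flow. States from which
every scheduler reaches `T` with positive probability (`Forced`) keep no mass outside `T`.
Conversely, normalizing a flow gives a memoryless scheduler with the right absorption probabilities
(`tendsto_absorption`), provided all mass outside `T` ends in a set `Z` where the flow stops and
where one can stay forever.

The obstacle is mass left at a state `s₁` outside `T ∪ Z`: a history-dependent scheduler can both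
remain around `s₁` and leave, a memoryless one cannot. Take `Z` maximal among the sets admitting a
refuting balance, and then maximize `p + u`. If mass is left at `s₁`, enlarge `Z` to `Z'` by the
states safely reachable from `s₁` and cut the flow at `Z'`, which gives `β = βA + b`. By maximality
`βA` does not refute. Along `βA + t • b` the function `p * (u + w) - w` is a convex quadratic in
`t`, at most `0` at `t = 0` and at least `0` at `t = 1`, so it is still at least `0` at `t = 1 + ε`.
The mass at `s₁` pays for the deficit that this extrapolation creates in `Z'`, and `p + u` strictly
grows, a contradiction (`IsBalance.exists_better`). -/

/-! ### Closed cones and a fixed point for cutting flows -/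

/-- Carathéodory's argument: where `L` is injective it is a closed embedding; otherwise moving along
a kernel vector reaches the boundary of the orthant, so the cone is a finite union of cones over
smaller index sets. -/
theorem isClosed_image_nonneg_supported {ι E : Type*} [Fintype ι] [DecidableEq ι]
    [NormedAddCommGroup E] [NormedSpace ℝ E] (L : (ι → ℝ) →ₗ[ℝ] E) (J : Finset ι) :
    IsClosed (L '' {y | 0 ≤ y ∧ ∀ i ∉ J, y i = 0}) := by
  induction J using Finset.strongInduction with
  | H J ih =>
    by_cases hinj : ∀ z : ι → ℝ, (∀ i ∉ J, z i = 0) → L z = 0 → z = 0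
    · let V : Submodule ℝ (ι → ℝ) :=
        { carrier := {z | ∀ i ∉ J, z i = 0}
          add_mem' := fun {a b} ha hb i hi => by simp [ha i hi, hb i hi]
          zero_mem' := fun i _ => rfl
          smul_mem' := fun c a ha i hi => by simp [ha i hi] }
      have hker : LinearMap.ker (L ∘ₗ V.subtype) = ⊥ := by
        rw [LinearMap.ker_eq_bot']
        intro z hz
        exact Subtype.ext (hinj z z.2 hz)
      have hemb := LinearMap.isClosedEmbedding_of_injective hker
      have himg : L '' {y | 0 ≤ y ∧ ∀ i ∉ J, y i = 0}
          = (L ∘ₗ V.subtype) '' {z : V | 0 ≤ (z : ι → ℝ)} := by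
        ext x
        constructor
        · rintro ⟨y, ⟨hy, hJ⟩, rfl⟩
          exact ⟨⟨y, hJ⟩, hy, rfl⟩
        · rintro ⟨y, hy, rfl⟩
          exact ⟨y, ⟨hy, y.2⟩, rfl⟩
      rw [himg]
      exact hemb.isClosedMap _ (isClosed_le continuous_const continuous_subtype_val)
    · push Not at hinj
      obtain ⟨z, hzJ, hLz, hz⟩ := hinj
      wlog hpos : ∃ i, 0 < z i generalizing z
      · refine this (-z) (fun i hi => by simp [hzJ i hi]) (by simp [hLz]) (by simpa using hz) ?_
        by_contra! hneg
        push Not at hpos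
        refine hz (funext fun i => le_antisymm (hpos i) ?_)
        simpa using hneg i
      have hunion : L '' {y | 0 ≤ y ∧ ∀ i ∉ J, y i = 0}
          = ⋃ j ∈ J, L '' {y | 0 ≤ y ∧ ∀ i ∉ J.erase j, y i = 0} := by
        ext x
        simp only [Set.mem_iUnion]
        constructor
        · rintro ⟨y, ⟨hy, hyJ⟩, rfl⟩
          -- Ratio test: `y j / z j` is the largest multiple of `z` that can be subtracted from `y`
          -- keeping all coordinates nonnegative, and it kills coordinate `j`.
          obtain ⟨j, hj, hmin⟩ := Finset.exists_min_image (Finset.univ.filter fun i => 0 < z i)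
            (fun i => y i / z i) (by obtain ⟨i, hi⟩ := hpos; exact ⟨i, by simpa using hi⟩)
          have hzj : 0 < z j := by simpa using hj
          have hjJ : j ∈ J := by
            by_contra h
            exact hzj.ne' (hzJ j h)
          refine ⟨j, hjJ, y - (y j / z j) • z, ⟨fun i => ?_, fun i hi => ?_⟩, by simp [hLz]⟩
          · simp only [Pi.zero_apply, Pi.sub_apply, Pi.smul_apply, smul_eq_mul, sub_nonneg]
            rcases le_or_gt (z i) 0 with h | h
            · exact (mul_nonpos_of_nonneg_of_nonpos (div_nonneg (hy j) hzj.le) h).trans (hy i)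
            · rw [← le_div_iff₀ h]
              exact hmin i (by simpa using h)
          · by_cases hij : i = j
            · subst hij
              simp [hzj.ne']
            · have hi' : i ∉ J := fun h => hi (Finset.mem_erase.2 ⟨hij, h⟩)
              simp [hyJ i hi', hzJ i hi']
        · rintro ⟨j, hj, y, ⟨hy, hyJ⟩, rfl⟩
          exact ⟨y, ⟨hy, fun i hi => hyJ i fun h => hi (Finset.mem_of_mem_erase h)⟩, rfl⟩
      rw [hunion]
      exact Set.Finite.isClosed_biUnion J.finite_toSet fun j hj => ih _ (Finset.erase_ssubset hj)

/-- Read `δ` as the source and `a t s` as the mass sent from `t` to `s`: `θ s` is a fraction of the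
mass through `s` to be counted as not having met `U` yet. It is the limit of a monotone iteration
downwards from `1`; uniqueness plays no role. -/
theorem exists_fixed_fraction {S : Type*} [Fintype S] (δ : S → ℝ) (a : S → S → ℝ) (U : Set S)
    (hδ : 0 ≤ δ) (ha : ∀ t s, 0 ≤ a t s) :
    ∃ θ : S → ℝ, 0 ≤ θ ∧ θ ≤ 1 ∧ (∀ s ∈ U, θ s = 0) ∧
      ∀ s ∉ U, θ s * (δ s + ∑ t, a t s) = δ s + ∑ t, θ t * a t s := by
  classical
  -- Where no mass arrives the quotient is `0` by the convention `x / 0 = 0`; both sides of the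
  -- claimed equation vanish there.
  set F : (S → ℝ) → S → ℝ := fun θ s =>
    if s ∈ U then 0 else (δ s + ∑ t, θ t * a t s) / (δ s + ∑ t, a t s) with hF
  have hY : ∀ s, 0 ≤ δ s + ∑ t, a t s := fun s =>
    add_nonneg (hδ s) (Finset.sum_nonneg fun t _ => ha t s)
  have hmono : Monotone F := by
    intro θ θ' h s
    simp only [hF]
    split_ifs
    · exact le_rfl
    · exact div_le_div_of_nonneg_right (add_le_add_right (Finset.sum_le_sum fun t _ =>
        mul_le_mul_of_nonneg_right (h t) (ha t s)) _) (hY s)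
  have hF1 : F 1 ≤ 1 := by
    intro s
    simp only [hF]
    split_ifs
    · exact zero_le_one
    · simpa using div_self_le_one (δ s + ∑ t, a t s)
  have hF0 : 0 ≤ F 0 := by
    intro s
    simp only [hF]
    split_ifs
    · exact le_rfl
    · simpa using div_nonneg (hδ s) (hY s)
  have hanti : Antitone fun n => F^[n] 1 := hmono.antitone_iterate_of_map_le hF1
  have hnn : ∀ n, 0 ≤ F^[n] 1 := by
    intro n
    induction n with
    | zero => exact fun _ => zero_le_one
    | succ n ih =>
      rw [Function.iterate_succ_apply']
      exact hF0.trans (hmono ih)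
  have hlim : Filter.Tendsto (fun n => F^[n] 1) Filter.atTop (nhds fun s => ⨅ n, F^[n] 1 s) := by
    rw [tendsto_pi_nhds]
    intro s
    exact tendsto_atTop_ciInf (fun m n h => hanti h s) ⟨0, by rintro _ ⟨n, rfl⟩; exact hnn n s⟩
  set θ : S → ℝ := fun s => ⨅ n, F^[n] 1 s
  have hcont : Continuous F := by
    refine continuous_pi fun s => ?_
    simp only [hF]
    split_ifs
    · exact continuous_const
    · fun_prop
  have hfix : F θ = θ := by
    have h1 := (hcont.tendsto θ).comp hlim
    refine tendsto_nhds_unique h1 ?_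
    have h2 := (Filter.tendsto_add_atTop_iff_nat 1).2 hlim
    simpa only [Function.iterate_succ_apply', Function.comp_def] using h2
  have h0 : 0 ≤ θ := ge_of_tendsto' hlim hnn
  have h1 : θ ≤ 1 := le_of_tendsto' hlim fun n => hanti (Nat.zero_le n)
  refine ⟨θ, h0, h1, fun s hs => ?_, fun s hs => ?_⟩
  · rw [← hfix]
    simp [hF, hs]
  · have hle : δ s + ∑ t, θ t * a t s ≤ δ s + ∑ t, a t s :=
      add_le_add_right (Finset.sum_le_sum fun t _ => mul_le_of_le_one_left (ha t s) (h1 t)) _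
    have hge : 0 ≤ δ s + ∑ t, θ t * a t s :=
      add_nonneg (hδ s) (Finset.sum_nonneg fun t _ => mul_nonneg (h0 t) (ha t s))
    rcases (hY s).eq_or_lt with h | h
    · rw [← h] at hle ⊢
      rw [mul_zero]
      exact le_antisymm hge hle
    · conv_lhs => rw [← hfix]
      simp only [hF, hs, if_false]
      exact div_mul_cancel₀ _ h.ne'

/-! ### Flows, net flows and balances -/

namespace MDP

variable {S Act : Type*} [Fintype S]

/-- The states from which the set `T` is reached with positive probability under every scheduler. -/
inductive Forced (M : MDP S Act) (T : Set S) : S → Prop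
  | base (s : S) : s ∈ T → M.Forced T s
  | step (s : S) (hs : ¬ M.IsTerminal s) (f : M.EnabledAct s → S)
      (hf : ∀ α, M.P s α.1 (f α) ≠ 0) (ih : ∀ α, M.Forced T (f α)) : M.Forced T s

theorem exists_enabled_not_forced (M : MDP S Act) {T : Set S} {s : S} (h : ¬ M.Forced T s)
    (hs : ¬ M.IsTerminal s) :
    ∃ α, M.Enabled s α ∧ ∀ t, M.P s α t ≠ 0 → ¬ M.Forced T t := by
  by_contra! hcon
  choose f hf using fun α : M.EnabledAct s => hcon α.1 α.2
  exact h (.step s hs f (fun α => (hf α).1) fun α => (hf α).2)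

/-- A set of states in which one can stay forever, and none of which is forced to reach `T`. -/
def SafeClosed (M : MDP S Act) (T Z : Set S) : Prop :=
  ∀ s ∈ Z, ¬ M.Forced T s ∧
    (M.IsTerminal s ∨ ∃ α, M.Enabled s α ∧ ∀ t, M.P s α t ≠ 0 → t ∈ Z)

theorem sum_coe_P (M : MDP S Act) {s : S} {α : Act} (h : M.Enabled s α) :
    ∑ t, (M.P s α t : ℝ) = 1 := by
  have h' : ∑ t, M.P s α t = 1 := h
  exact_mod_cast h'

/-- Nonnegative flows that use only enabled actions of states outside `X`. -/
structure IsFlow (M : MDP S Act) (X : Set S) (y : S × Act → ℝ) : Prop where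
  nonneg : 0 ≤ y
  supp : ∀ i, y i ≠ 0 → i.1 ∉ X ∧ M.Enabled i.1 i.2

theorem IsFlow.add {M : MDP S Act} {X : Set S} {y z : S × Act → ℝ} (hy : M.IsFlow X y)
    (hz : M.IsFlow X z) : M.IsFlow X (y + z) where
  nonneg := add_nonneg hy.nonneg hz.nonneg
  supp i hi := by
    by_cases h : y i = 0
    · refine hz.supp i fun h' => hi ?_
      simp [h, h']
    · exact hy.supp i h

theorem IsFlow.smul {M : MDP S Act} {X : Set S} {y : S × Act → ℝ} (hy : M.IsFlow X y) {c : ℝ}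
    (hc : 0 ≤ c) : M.IsFlow X (c • y) where
  nonneg := smul_nonneg hc hy.nonneg
  supp i hi := hy.supp i fun h => hi (by simp [h])

theorem isFlow_zero (M : MDP S Act) (X : Set S) : M.IsFlow X 0 :=
  ⟨le_rfl, fun _ hi => absurd rfl hi⟩

theorem IsFlow.sum {M : MDP S Act} {X : Set S} {ι : Type*} (J : Finset ι)
    {y : ι → S × Act → ℝ} (hy : ∀ j ∈ J, M.IsFlow X (y j)) : M.IsFlow X (∑ j ∈ J, y j) :=
  Finset.sum_induction y (M.IsFlow X) (fun _ _ h h' => h.add h') (M.isFlow_zero X) hy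

open Classical in
theorem isFlow_single (M : MDP S Act) {X : Set S} {s : S} {α : Act} (hs : s ∉ X)
    (hα : M.Enabled s α) : M.IsFlow X (Pi.single (s, α) 1) where
  nonneg := Pi.single_nonneg.2 zero_le_one
  supp i hi := by
    have : i = (s, α) := by
      by_contra h
      exact hi (Pi.single_eq_of_ne h _)
    subst this
    exact ⟨hs, hα⟩

variable [Fintype Act]

open Classical in
/-- The inflow minus the outflow of every state, for a flow on state-action pairs. -/
noncomputable def netFlow (M : MDP S Act) : (S × Act → ℝ) →ₗ[ℝ] (S → ℝ) :=
  Fintype.linearCombination ℝ fun i t => (M.P i.1 i.2 t : ℝ) - (Pi.single i.1 1 : S → ℝ) t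

open Classical in
theorem netFlow_apply (M : MDP S Act) (y : S × Act → ℝ) (t : S) :
    M.netFlow y t = ∑ i, y i * ((M.P i.1 i.2 t : ℝ) - (Pi.single i.1 1 : S → ℝ) t) := by
  simp [netFlow, Fintype.linearCombination_apply]

open Classical in
theorem netFlow_single (M : MDP S Act) (s : S) (α : Act) :
    M.netFlow (Pi.single (s, α) 1) = (fun t => (M.P s α t : ℝ)) - Pi.single s 1 := by
  ext t
  rw [netFlow_apply, Finset.sum_eq_single (s, α)]
  · simp
  · intro b _ hb
    simp [Pi.single_eq_of_ne hb]
  · simp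

theorem IsFlow.sum_netFlow {M : MDP S Act} {X : Set S} {y : S × Act → ℝ} (hy : M.IsFlow X y) :
    ∑ t, M.netFlow y t = 0 := by
  classical
  simp only [netFlow_apply]
  rw [Finset.sum_comm]
  refine Finset.sum_eq_zero fun i _ => ?_
  rw [← Finset.mul_sum]
  by_cases h : y i = 0
  · simp [h]
  · simp [M.sum_coe_P (hy.supp i h).2]

theorem IsFlow.netFlow_nonneg {M : MDP S Act} {X : Set S} {y : S × Act → ℝ} (hy : M.IsFlow X y)
    {t : S} (ht : t ∈ X) : 0 ≤ M.netFlow y t := by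
  classical
  rw [netFlow_apply]
  refine Finset.sum_nonneg fun i _ => ?_
  by_cases h : y i = 0
  · simp [h]
  · have hne : t ≠ i.1 := fun h' => (hy.supp i h).1 (h' ▸ ht)
    rw [Pi.single_eq_of_ne hne, sub_zero]
    exact mul_nonneg (hy.nonneg i) (NNReal.coe_nonneg _)

open Classical in
/-- `β` is the distribution of the states in which the flow `y` from `s₀` ends: the flow stops in
`T ∪ Z`, and otherwise may end only in states that are not forced to reach `T`. -/
structure IsBalance (M : MDP S Act) (T Z : Set S) (s₀ : S) (y : S × Act → ℝ) (β : S → ℝ) :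
    Prop where
  flow : M.IsFlow (T ∪ Z) y
  eq : β = Pi.single s₀ 1 + M.netFlow y
  nonneg : 0 ≤ β
  forced : ∀ s, M.Forced T s → s ∉ T → β s = 0

theorem IsBalance.sum_eq_one {M : MDP S Act} {T Z : Set S} {s₀ : S} {y : S × Act → ℝ}
    {β : S → ℝ} (h : M.IsBalance T Z s₀ y β) : ∑ s, β s = 1 := by
  simp [h.eq, Finset.sum_add_distrib, h.flow.sum_netFlow]

theorem isClosed_netFlow (M : MDP S Act) (X : Set S) :
    IsClosed {b | ∃ y, M.IsFlow X y ∧ b = M.netFlow y} := by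
  classical
  have heq : {b | ∃ y, M.IsFlow X y ∧ b = M.netFlow y} = M.netFlow '' {y | 0 ≤ y ∧
      ∀ i ∉ Finset.univ.filter fun i : S × Act => i.1 ∉ X ∧ M.Enabled i.1 i.2, y i = 0} := by
    ext b
    constructor
    · rintro ⟨y, hy, rfl⟩
      refine ⟨y, ⟨hy.nonneg, fun i hi => ?_⟩, rfl⟩
      by_contra h
      exact hi (by simpa using hy.supp i h)
    · rintro ⟨y, ⟨hy, hs⟩, rfl⟩
      refine ⟨y, ⟨hy, fun i hi => ?_⟩, rfl⟩
      by_contra h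
      exact hi (hs i (by simpa using h))
  rw [heq]
  exact isClosed_image_nonneg_supported _ _

/-- Conservation of mass puts `β` in the simplex. The flows `y` can be unbounded because of
circulations, so compactness is available for `β` only and rests on the closedness of the cone of
net flows. -/
theorem isCompact_balance (M : MDP S Act) (T Z : Set S) (s₀ : S) :
    IsCompact {β | ∃ y, M.IsBalance T Z s₀ y β} := by
  classical
  have hclosed : IsClosed ({β : S → ℝ | ∀ s, M.Forced T s → s ∉ T → β s = 0} ∩
      ((fun β => β - Pi.single s₀ 1) ⁻¹' {b | ∃ y, M.IsFlow (T ∪ Z) y ∧ b = M.netFlow y})) := by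
    refine IsClosed.inter ?_ ((M.isClosed_netFlow _).preimage (by fun_prop))
    simp only [Set.ofPred_forall]
    exact isClosed_iInter fun s => isClosed_iInter fun _ => isClosed_iInter fun _ =>
      isClosed_eq (continuous_apply s) continuous_const
  have heq : {β | ∃ y, M.IsBalance T Z s₀ y β} = stdSimplex ℝ S ∩
      ({β : S → ℝ | ∀ s, M.Forced T s → s ∉ T → β s = 0} ∩
      ((fun β => β - Pi.single s₀ 1) ⁻¹' {b | ∃ y, M.IsFlow (T ∪ Z) y ∧ b = M.netFlow y})) := by
    ext β
    constructor
    · rintro ⟨y, hy⟩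
      exact ⟨⟨hy.nonneg, hy.sum_eq_one⟩, hy.forced, y, hy.flow, by simp [hy.eq]⟩
    · rintro ⟨⟨h0, h1⟩, hf, y, hy, heq⟩
      exact ⟨y, hy, by rw [← heq]; simp, h0, hf⟩
  rw [heq]
  exact (isCompact_stdSimplex ℝ S).inter_right hclosed

/-- Cutting the flow at `Z'`: `yA = θ y` is the part before `Z'` and `yB = (1 - θ) y` the rest.
Outside `T ∪ Z'` the fixed-point equation makes the mass that ends in `s` split in the same ratio,
so only states of `Z'` can lose mass through `yB`. -/
theorem IsBalance.exists_split {M : MDP S Act} {T Z Z' : Set S} {s₀ : S} {y : S × Act → ℝ}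
    {β : S → ℝ} (h : M.IsBalance T Z s₀ y β) (hZ' : ∀ s ∈ Z', ¬ M.Forced T s) :
    ∃ yA yB βA, M.IsBalance T Z' s₀ yA βA ∧ M.IsFlow (T ∪ Z) yB ∧ β = βA + M.netFlow yB ∧
      ∀ s ∉ Z', 0 ≤ M.netFlow yB s := by
  classical
  obtain ⟨θ, h0, h1, hU, hfix⟩ := exists_fixed_fraction (Pi.single s₀ 1)
    (fun t s => ∑ α, y (t, α) * M.P t α s) (T ∪ Z') (Pi.single_nonneg.2 zero_le_one)
    (fun t s => Finset.sum_nonneg fun α _ => mul_nonneg (h.flow.nonneg _) (NNReal.coe_nonneg _))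
  set yA : S × Act → ℝ := fun i => θ i.1 * y i with hyA
  set yB : S × Act → ℝ := fun i => (1 - θ i.1) * y i with hyB
  have hflowA : M.IsFlow (T ∪ Z') yA := by
    refine ⟨fun i => mul_nonneg (h0 _) (h.flow.nonneg i), fun i hi => ⟨fun hX => hi ?_, ?_⟩⟩
    · simp [hyA, hU _ hX]
    · exact (h.flow.supp i fun h' => hi (by simp [hyA, h'])).2
  have hflowB : M.IsFlow (T ∪ Z) yB := by
    refine ⟨fun i => mul_nonneg (sub_nonneg.2 (h1 _)) (h.flow.nonneg i), fun i hi => ?_⟩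
    exact h.flow.supp i fun h' => hi (by simp [hyB, h'])
  have hadd : y = yA + yB := by
    ext i
    simp only [hyA, hyB, Pi.add_apply]
    ring
  have hsplit : β = Pi.single s₀ 1 + M.netFlow yA + M.netFlow yB := by
    rw [h.eq, hadd, map_add, add_assoc]
  -- Used for `c = θ` and for `c = 1`; comparing the two gives `βA s = θ s * β s` off `T ∪ Z'`.
  have hnet : ∀ (c : S → ℝ) s, M.netFlow (fun i => c i.1 * y i) s
      = (∑ t, c t * ∑ α, y (t, α) * M.P t α s) - c s * ∑ α, y (s, α) := by
    intro c s
    rw [netFlow_apply, Fintype.sum_prod_type]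
    simp only [mul_sub, Finset.sum_sub_distrib]
    congr 1
    · refine Finset.sum_congr rfl fun t _ => ?_
      rw [Finset.mul_sum]
      exact Finset.sum_congr rfl fun α _ => by ring
    · rw [Finset.sum_eq_single s]
      · simp [Finset.mul_sum]
      · intro t _ hts
        simp [Pi.single_eq_of_ne hts.symm]
      · simp
  have hβA : ∀ s ∉ T ∪ Z', (Pi.single s₀ 1 + M.netFlow yA : S → ℝ) s = θ s * β s := by
    intro s hs
    have e1 := hfix s hs
    have e2 := hnet θ s
    have e3 := hnet 1 s
    simp only [Pi.one_apply, one_mul] at e3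
    rw [h.eq, Pi.add_apply, Pi.add_apply, hyA, e2, e3, ← add_sub_assoc, ← e1]
    ring
  refine ⟨yA, yB, Pi.single s₀ 1 + M.netFlow yA, ⟨hflowA, rfl, fun s => ?_, fun s hs hT => ?_⟩,
    hflowB, hsplit, fun s hs => ?_⟩
  · by_cases hs : s ∈ T ∪ Z'
    · exact add_nonneg ((Pi.single_nonneg.2 zero_le_one : (0 : S → ℝ) ≤ Pi.single s₀ 1) s)
        (hflowA.netFlow_nonneg hs)
    · rw [hβA s hs]
      exact mul_nonneg (h0 s) (h.nonneg s)
  · have hs' : s ∉ T ∪ Z' := fun h' => h'.elim hT fun hz => hZ' s hz hs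
    rw [hβA s hs', h.forced s hs hT, mul_zero]
  · by_cases hT : s ∈ T
    · exact hflowB.netFlow_nonneg (Or.inl hT)
    · have hs' : s ∉ T ∪ Z' := fun h' => h'.elim hT hs
      have e := congrFun hsplit s
      rw [Pi.add_apply, hβA s hs'] at e
      have : M.netFlow yB s = (1 - θ s) * β s := by linarith
      rw [this]
      exact mul_nonneg (sub_nonneg.2 (h1 s)) (h.nonneg s)

end MDP

/-! ### Improving a refuting balance -/

namespace MDP

variable {S Act : Type*} [Fintype S] [Fintype Act]

open Classical in
/-- The states `t` to which a positive fraction of a unit of mass in `s₀` can be moved without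
risking to be forced into `T`. -/
def InnerReach (M : MDP S Act) (T Z : Set S) (s₀ t : S) : Prop :=
  ¬ M.Forced T t ∧ ∃ (z : S × Act → ℝ) (ρ : ℝ), 0 < ρ ∧ M.IsFlow (T ∪ Z) z ∧
    (ρ • Pi.single t 1 ≤ Pi.single s₀ 1 + M.netFlow z) ∧ ∀ s, M.Forced T s → M.netFlow z s = 0

theorem innerReach_self (M : MDP S Act) {T Z : Set S} {s : S} (hs : ¬ M.Forced T s) :
    M.InnerReach T Z s s :=
  ⟨hs, 0, 1, one_pos, M.isFlow_zero _, by simp, by simp⟩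

/-- Push the mass `ρ` sitting in `t` along `α`: a share `ρ * M.P t α t'` lands in `t'`, and no
forced state is touched since `t` and all its `α`-successors are not forced. -/
theorem InnerReach.step {M : MDP S Act} {T Z : Set S} {s₀ t : S} (h : M.InnerReach T Z s₀ t)
    (ht : t ∉ Z) {α : Act} (hα : M.Enabled t α) (hsafe : ∀ t', M.P t α t' ≠ 0 → ¬ M.Forced T t')
    {t' : S} (ht' : M.P t α t' ≠ 0) : M.InnerReach T Z s₀ t' := by
  classical
  obtain ⟨hf, z, ρ, hρ, hz, hle, h0⟩ := h
  have htT : t ∉ T ∪ Z := fun h' => h'.elim (fun hT => hf (.base t hT)) ht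
  have hP : 0 < (M.P t α t' : ℝ) := NNReal.coe_pos.2 (pos_iff_ne_zero.2 ht')
  refine ⟨hsafe t' ht', z + ρ • Pi.single (t, α) 1, ρ * M.P t α t', mul_pos hρ hP,
    hz.add ((M.isFlow_single htT hα).smul hρ.le), ?_, ?_⟩
  · rw [map_add, map_smul, netFlow_single]
    intro s
    have h1 := hle s
    simp only [Pi.smul_apply, Pi.add_apply, Pi.sub_apply, smul_eq_mul] at h1 ⊢
    have h2 : ρ * M.P t α t' * (Pi.single t' 1 : S → ℝ) s ≤ ρ * M.P t α s := by
      by_cases hs : s = t'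
      · subst hs; simp
      · rw [Pi.single_eq_of_ne hs, mul_zero]
        exact mul_nonneg hρ.le (NNReal.coe_nonneg _)
    linarith
  · intro s hs
    have h1 : M.P t α s = 0 := by
      by_contra h
      exact hsafe s h hs
    have h2 : s ≠ t := by
      rintro rfl
      exact hf hs
    simp [netFlow_single, h0 s hs, h1, Pi.single_eq_of_ne h2]

/-- A non-forced, non-terminal state has an action all of whose successors are not forced, and these
successors are again inner reachable. -/
theorem SafeClosed.union_innerReach {M : MDP S Act} {T Z : Set S} (hZ : M.SafeClosed T Z) (s₀ : S) :
    M.SafeClosed T (Z ∪ {t | M.InnerReach T Z s₀ t}) := by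
  intro s hs
  by_cases hsZ : s ∈ Z
  · refine ⟨(hZ s hsZ).1, (hZ s hsZ).2.imp id ?_⟩
    rintro ⟨α, hα, h⟩
    exact ⟨α, hα, fun t ht => Or.inl (h t ht)⟩
  · have hr : M.InnerReach T Z s₀ s := hs.resolve_left hsZ
    refine ⟨hr.1, or_iff_not_imp_left.2 fun hterm => ?_⟩
    obtain ⟨α, hα, h⟩ := M.exists_enabled_not_forced hr.1 hterm
    exact ⟨α, hα, fun t ht => Or.inr (hr.step hsZ hα h ht)⟩

-- Superposition of the flows witnessing `InnerReach`: a large enough amount `c` in `s₀` supplies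
-- any demand `k` on inner reachable states, without changing the mass of forced states.
open Classical in
theorem exists_flow_of_innerReach (M : MDP S Act) {T Z : Set S} {s₀ : S} (k : S → ℝ) (hk : 0 ≤ k)
    (hkR : ∀ s, k s ≠ 0 → M.InnerReach T Z s₀ s) :
    ∃ (z : S × Act → ℝ) (c : ℝ), 0 ≤ c ∧ M.IsFlow (T ∪ Z) z ∧
      (k ≤ c • Pi.single s₀ 1 + M.netFlow z) ∧ ∀ s, M.Forced T s → M.netFlow z s = 0 := by
  have hex : ∀ t, ∃ (z : S × Act → ℝ) (c : ℝ), 0 ≤ c ∧ M.IsFlow (T ∪ Z) z ∧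
      (k t • Pi.single t 1 ≤ c • Pi.single s₀ 1 + M.netFlow z) ∧
      ∀ s, M.Forced T s → M.netFlow z s = 0 := by
    intro t
    by_cases ht : k t = 0
    · exact ⟨0, 0, le_rfl, M.isFlow_zero _, by simp [ht], by simp⟩
    · obtain ⟨-, z, ρ, hρ, hz, hle, h0⟩ := hkR t ht
      have hc : 0 ≤ k t / ρ := div_nonneg (hk t) hρ.le
      refine ⟨(k t / ρ) • z, k t / ρ, hc, hz.smul hc, ?_, fun s hs => by simp [h0 s hs]⟩
      rw [map_smul, ← smul_add]
      calc k t • (Pi.single t 1 : S → ℝ) = (k t / ρ) • ρ • (Pi.single t 1 : S → ℝ) := by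
            rw [smul_smul, div_mul_cancel₀ _ hρ.ne']
        _ ≤ _ := smul_le_smul_of_nonneg_left hle hc
  choose z c hc hz hle h0 using hex
  refine ⟨∑ t, z t, ∑ t, c t, Finset.sum_nonneg fun t _ => hc t, IsFlow.sum _ fun t _ => hz t, ?_,
    fun s hs => ?_⟩
  · rw [Finset.sum_smul, map_sum, ← Finset.sum_add_distrib]
    calc k = ∑ t, k t • (Pi.single t 1 : S → ℝ) := by
          ext s
          simp [Finset.sum_apply, Pi.single_apply]
      _ ≤ _ := Finset.sum_le_sum fun t _ => hle t
  · rw [map_sum, Finset.sum_apply]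
    exact Finset.sum_eq_zero fun t _ => h0 t s hs

/-- The quadratic condition on the linear functionals `p`, `u`, `w` that expresses the failure of
the probability-raising inequality. -/
def Refuting (rp ru rw β : S → ℝ) : Prop :=
  0 < rp ⬝ᵥ β ∧ rw ⬝ᵥ β ≤ (rp ⬝ᵥ β) * (ru ⬝ᵥ β + rw ⬝ᵥ β)

theorem dotProduct_nonneg_of_support {T : Set S} {r b : S → ℝ} (hr : 0 ≤ r) (hrT : ∀ s ∉ T, r s = 0)
    (hb : ∀ s ∈ T, 0 ≤ b s) : 0 ≤ r ⬝ᵥ b := by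
  refine Finset.sum_nonneg fun s _ => ?_
  by_cases hs : s ∈ T
  · exact mul_nonneg (hr s) (hb s hs)
  · rw [hrT s hs, zero_mul]

theorem dotProduct_le_of_support {T : Set S} {r r' b : S → ℝ} (hr : r ≤ r')
    (hrT : ∀ s ∉ T, r s = 0) (hrT' : ∀ s ∉ T, r' s = 0)
    (hb : ∀ s ∈ T, 0 ≤ b s) : r ⬝ᵥ b ≤ r' ⬝ᵥ b := by
  have := dotProduct_nonneg_of_support (T := T) (r := r' - r) (b := b) (sub_nonneg.2 hr)
    (fun s hs => by simp [hrT s hs, hrT' s hs]) hb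
  rw [sub_dotProduct] at this
  linarith

/-- The extrapolation step. With `β = βA + b` cut at the enlarged set `Z'`, the improved balance is
`βA + (1 + ε) • b` plus `ε` times a correction that moves mass from `s₁` to the states of `Z'` where
`b` is negative. -/
theorem IsBalance.exists_better {M : MDP S Act} {T Z : Set S} {s₀ : S} {rp ru rw : S → ℝ}
    (hrp : 0 ≤ rp) (hru : 0 ≤ ru) (hrw : 0 ≤ rw) (hle : rw ≤ rp) (hrpT : ∀ s ∉ T, rp s = 0)
    (hruT : ∀ s ∉ T, ru s = 0) (hZ : M.SafeClosed T Z)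
    (hmax : ∀ Z', M.SafeClosed T Z' → Z ⊂ Z' →
      ∀ y β, M.IsBalance T Z' s₀ y β → ¬ Refuting rp ru rw β)
    {y : S × Act → ℝ} {β : S → ℝ} (h : M.IsBalance T Z s₀ y β) (href : Refuting rp ru rw β)
    {s₁ : S} (hs₁ : s₁ ∉ T ∪ Z) (hβ : β s₁ ≠ 0) :
    ∃ y' β', M.IsBalance T Z s₀ y' β' ∧ Refuting rp ru rw β' ∧ rp ⬝ᵥ β ≤ rp ⬝ᵥ β' ∧
      (rp + ru) ⬝ᵥ β < (rp + ru) ⬝ᵥ β' := by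
  classical
  have hrwT : ∀ s ∉ T, rw s = 0 := fun s hs =>
    le_antisymm ((hle s).trans_eq (hrpT s hs)) (hrw s)
  have hs₁T : s₁ ∉ T := fun h' => hs₁ (Or.inl h')
  have hs₁Z : s₁ ∉ Z := fun h' => hs₁ (Or.inr h')
  have hs₁F : ¬ M.Forced T s₁ := fun h' => hβ (h.forced s₁ h' hs₁T)
  set Z' := Z ∪ {t | M.InnerReach T Z s₁ t} with hZ'def
  have hZ' : M.SafeClosed T Z' := hZ.union_innerReach s₁
  have hss : Z ⊂ Z' := by
    refine ⟨Set.subset_union_left, fun hsub => hs₁Z (hsub (Or.inr ?_))⟩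
    exact M.innerReach_self hs₁F
  obtain ⟨yA, yB, βA, hA, hB, hsplit, hBnn⟩ := h.exists_split fun s hs => (hZ' s hs).1
  have hAr := hmax Z' hZ' hss yA βA hA
  set b := M.netFlow yB with hb
  have hbT : ∀ s ∈ T, 0 ≤ b s := fun s hs => hB.netFlow_nonneg (Or.inl hs)
  -- Only in `Z' \ Z` can `b` be negative: on `Z` the flow `yB` has no outflow, and outside `Z'` the
  -- split guarantees nonnegativity. The demand `|b s|` covers the loss.
  obtain ⟨z, c, hc, hz, hkle, hz0⟩ := M.exists_flow_of_innerReach (T := T) (Z := Z) (s₀ := s₁)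
    (fun s => if s ∈ Z' ∧ s ∉ Z then |b s| else 0)
    (fun s => by dsimp only; split_ifs <;> simp)
    (fun s hs => by
      by_cases h' : s ∈ Z' ∧ s ∉ Z
      · exact h'.1.resolve_left h'.2
      · exact absurd (if_neg h') hs)
  have hβpos : 0 < β s₁ := lt_of_le_of_ne (h.nonneg s₁) (Ne.symm hβ)
  -- Chosen so that `ε * c ≤ β s₁`, the mass available in `s₁`; the `+ 1` keeps the denominator
  -- positive.
  set ε := β s₁ / (c + 1) with hε
  have hεpos : 0 < ε := div_pos hβpos (by linarith)
  have hεc : ε * c ≤ β s₁ := by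
    rw [hε, div_mul_eq_mul_div, div_le_iff₀ (by linarith)]
    nlinarith
  -- The correction `z` is invisible to functionals supported on `T`, because states of `T` are
  -- forced.
  have hr : ∀ r : S → ℝ, (∀ s ∉ T, r s = 0) →
      r ⬝ᵥ (β + ε • b + ε • M.netFlow z) = r ⬝ᵥ βA + (1 + ε) * (r ⬝ᵥ b) := by
    intro r hrT
    have h1 : r ⬝ᵥ M.netFlow z = 0 := by
      refine Finset.sum_eq_zero fun s _ => ?_
      by_cases hs : s ∈ T
      · rw [hz0 s (.base s hs), mul_zero]
      · rw [hrT s hs, zero_mul]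
    rw [dotProduct_add, dotProduct_add, dotProduct_smul, dotProduct_smul, h1, hsplit,
      dotProduct_add, smul_eq_mul, smul_zero]
    ring
  have hβr : ∀ r : S → ℝ, r ⬝ᵥ β = r ⬝ᵥ βA + r ⬝ᵥ b := fun r => by rw [hsplit, dotProduct_add]
  have hβAnn : ∀ s ∈ T, 0 ≤ βA s := fun s _ => hA.nonneg s
  have pa := dotProduct_nonneg_of_support hrp hrpT hβAnn
  have ua := dotProduct_nonneg_of_support hru hruT hβAnn
  have wa := dotProduct_nonneg_of_support hrw hrwT hβAnn
  have wpa := dotProduct_le_of_support hle hrwT hrpT hβAnn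
  have pb := dotProduct_nonneg_of_support hrp hrpT hbT
  have ub := dotProduct_nonneg_of_support hru hruT hbT
  have wb := dotProduct_nonneg_of_support hrw hrwT hbT
  have wpb := dotProduct_le_of_support hle hrwT hrpT hbT
  obtain ⟨hp, hf⟩ := href
  rw [hβr, hβr, hβr] at hf
  rw [hβr] at hp
  -- `βA` fails to refute either by this inequality or because `p = 0`; in the latter case the left
  -- side is `-w ≤ 0` anyway.
  have hfA : (rp ⬝ᵥ βA) * (ru ⬝ᵥ βA + rw ⬝ᵥ βA) - rw ⬝ᵥ βA ≤ 0 := by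
    by_contra! hcon
    rcases pa.eq_or_lt with h0 | h0
    · rw [← h0] at hcon
      linarith
    · exact hAr ⟨h0, by linarith⟩
  -- Otherwise all three functionals vanish on `b` (`w` being dominated by `p`), and `βA` would
  -- refute just as `β` does.
  have hstrict : 0 < rp ⬝ᵥ b + ru ⬝ᵥ b := by
    by_contra! hcon
    have h1 : rp ⬝ᵥ b = 0 := by linarith
    have h2 : ru ⬝ᵥ b = 0 := by linarith
    have h3 : rw ⬝ᵥ b = 0 := by linarith
    rw [h1, h2, h3] at hf
    rw [h1] at hp
    exact hAr ⟨by linarith, by linarith⟩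
  refine ⟨y + ε • yB + ε • z, β + ε • b + ε • M.netFlow z,
    ⟨(h.flow.add (hB.smul hεpos.le)).add (hz.smul hεpos.le), ?_, ?_, ?_⟩, ⟨?_, ?_⟩, ?_, ?_⟩
  · rw [map_add, map_add, map_smul, map_smul, ← hb, h.eq]
    abel
  · intro s
    have h1 := hkle s
    simp only [Pi.add_apply, Pi.smul_apply, smul_eq_mul, Pi.zero_apply] at h1 ⊢
    have h2 : 0 ≤ b s + if s ∈ Z' ∧ s ∉ Z then |b s| else 0 := by
      split_ifs with h'
      · linarith [neg_abs_le (b s)]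
      · rw [add_zero]
        by_cases hsZ : s ∈ Z
        · exact hB.netFlow_nonneg (Or.inr hsZ)
        · exact hBnn s fun h'' => h' ⟨h'', hsZ⟩
    have h3 : ε * c * (Pi.single s₁ 1 : S → ℝ) s ≤ β s := by
      by_cases hs : s = s₁
      · subst hs; simpa using hεc
      · rw [Pi.single_eq_of_ne hs, mul_zero]
        exact h.nonneg s
    have h4 : 0 ≤ ε * (b s + (c * (Pi.single s₁ 1 : S → ℝ) s + M.netFlow z s)) :=
      mul_nonneg hεpos.le (by linarith)
    linarith
  · intro s hs hsT
    have h1 := congrFun hsplit s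
    rw [Pi.add_apply, h.forced s hs hsT, hA.forced s hs hsT, zero_add] at h1
    simp [h.forced s hs hsT, hz0 s hs, ← h1]
  · rw [hr rp hrpT]
    linarith [mul_nonneg hεpos.le pb]
  · rw [hr rp hrpT, hr ru hruT, hr rw hrwT]
    generalize rp ⬝ᵥ βA = p at *
    generalize ru ⬝ᵥ βA = u at *
    generalize rw ⬝ᵥ βA = w at *
    generalize rp ⬝ᵥ b = p' at *
    generalize ru ⬝ᵥ b = u' at *
    generalize rw ⬝ᵥ b = w' at *
    -- Extrapolation of the quadratic `f` from its values at `0` and `1`: `f (1 + ε) = (1 + ε) * f 1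
    -- - ε * f 0 + ε * (1 + ε) * leading coefficient`, every summand being nonnegative.
    have key : (p + (1 + ε) * p') * (u + (1 + ε) * u' + (w + (1 + ε) * w')) - (w + (1 + ε) * w')
        = (1 + ε) * ((p + p') * (u + u' + (w + w')) - (w + w')) - ε * (p * (u + w) - w)
          + ε * (1 + ε) * (p' * (u' + w')) := by ring
    have k1 : 0 ≤ (1 + ε) * ((p + p') * (u + u' + (w + w')) - (w + w')) :=
      mul_nonneg (by linarith) (by linarith)
    have k2 : 0 ≤ ε * -(p * (u + w) - w) := mul_nonneg hεpos.le (by linarith)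
    have k3 : 0 ≤ ε * (1 + ε) * (p' * (u' + w')) :=
      mul_nonneg (mul_nonneg hεpos.le (by linarith)) (mul_nonneg pb (by linarith))
    linarith
  · rw [hr rp hrpT, hβr]
    linarith [mul_nonneg hεpos.le pb]
  · rw [add_dotProduct, add_dotProduct, hr rp hrpT, hr ru hruT, hβr, hβr]
    linarith [mul_pos hεpos hstrict]

/-- A refuting flow can be replaced with one that stops only in the target set and in a set of
states in which one can stay forever. -/
theorem exists_refuting_balance (M : MDP S Act) {T : Set S} {s₀ : S} {rp ru rw : S → ℝ}
    (hrp : 0 ≤ rp) (hru : 0 ≤ ru) (hrw : 0 ≤ rw) (hle : rw ≤ rp) (hrpT : ∀ s ∉ T, rp s = 0)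
    (hruT : ∀ s ∉ T, ru s = 0)
    (hex : ∃ y β, M.IsBalance T ∅ s₀ y β ∧ Refuting rp ru rw β) :
    ∃ Z y β, M.SafeClosed T Z ∧ M.IsBalance T Z s₀ y β ∧ Refuting rp ru rw β ∧
      ∀ s ∉ T ∪ Z, β s = 0 := by
  -- First extremal choice, over the finitely many sets `Z`; the empty set qualifies by the given
  -- balance.
  obtain ⟨Z, hZ⟩ := (Set.toFinite {Z : Set S | M.SafeClosed T Z ∧
    ∃ y β, M.IsBalance T Z s₀ y β ∧ Refuting rp ru rw β}).exists_maximal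
    ⟨∅, fun s hs => hs.elim, hex⟩
  obtain ⟨hZs, y₁, β₁, h₁, href₁⟩ := hZ.prop
  have hmax : ∀ Z', M.SafeClosed T Z' → Z ⊂ Z' →
      ∀ y β, M.IsBalance T Z' s₀ y β → ¬ Refuting rp ru rw β := fun Z' hZ' hss y β hb hr =>
    hss.2 (hZ.le_of_ge ⟨hZ', y, β, hb, hr⟩ hss.1)
  have hcont : ∀ r : S → ℝ, Continuous fun β : S → ℝ => r ⬝ᵥ β := fun r => by
    unfold dotProduct
    fun_prop
  -- Second extremal choice. Positivity of `p` is not a closed condition, so it is replaced with the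
  -- lower bound given by `β₁`, which `exists_better` preserves.
  have hcomp : IsCompact ({β | ∃ y, M.IsBalance T Z s₀ y β} ∩
      {β | rp ⬝ᵥ β₁ ≤ rp ⬝ᵥ β ∧ rw ⬝ᵥ β ≤ (rp ⬝ᵥ β) * (ru ⬝ᵥ β + rw ⬝ᵥ β)}) := by
    refine (M.isCompact_balance T Z s₀).inter_right (IsClosed.inter ?_ ?_)
    · exact isClosed_le continuous_const (hcont rp)
    · exact isClosed_le (hcont rw) ((hcont rp).mul ((hcont ru).add (hcont rw)))
  obtain ⟨β, ⟨⟨y, hy⟩, hβp, hβf⟩, hβmax⟩ := hcomp.exists_isMaxOn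
    ⟨β₁, ⟨y₁, h₁⟩, le_rfl, href₁.2⟩ (hcont (rp + ru)).continuousOn
  have hβr : Refuting rp ru rw β := ⟨href₁.1.trans_le hβp, hβf⟩
  refine ⟨Z, y, β, hZs, hy, hβr, fun s hs => ?_⟩
  by_contra hne
  obtain ⟨y', β', hy', hr', hp', hlt⟩ := hy.exists_better hrp hru hrw hle hrpT hruT hZs hmax hβr
    hs hne
  exact absurd (hβmax ⟨⟨y', hy'⟩, hβp.trans hp', hr'.2⟩) (not_le.2 hlt)

end MDP

/-! ### Absorption probabilities from a stationary flow -/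

open Classical in
/-- If a Markov chain with transition matrix `q` admits a stationary flow `Y` on `X` with source
`s₀` and sink distribution `β`, then `β` gives the absorption probabilities outside `X`. -/
theorem tendsto_absorption {S : Type*} [Fintype S] {q : S → S → ℝ} {X : Set S} {Y β : S → ℝ}
    {s₀ : S} {a : ℕ → S → ℝ} (hq0 : ∀ t s, 0 ≤ q t s) (hq1 : ∀ t, ∑ s, q t s = 1)
    (hX : ∀ t ∉ X, ∀ s ∈ X, q t s = 0) (hY : 0 ≤ Y) (hβX : ∀ s ∈ X, β s = 0)
    (hYX : ∀ s ∉ X, Y s = 0) (hβ1 : ∑ s, β s = 1)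
    (hflow : ∀ s, Y s + β s = (Pi.single s₀ 1 : S → ℝ) s + ∑ t, Y t * q t s)
    (ha0 : a 0 = Pi.single s₀ 1) (ha : ∀ n s, a (n + 1) s = ∑ t, a n t * q t s)
    {c : S} (hc : c ∉ X) (hcc1 : q c c = 1) (hcc : ∀ t ∉ X, t ≠ c → q t c = 0) :
    Filter.Tendsto (fun n => a n c) Filter.atTop (nhds (β c)) := by
  have hann : ∀ n, 0 ≤ a n := by
    intro n
    induction n with
    | zero => rw [ha0]; exact Pi.single_nonneg.2 zero_le_one
    | succ n ih =>
      intro s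
      rw [ha]
      exact Finset.sum_nonneg fun t _ => mul_nonneg (ih t) (hq0 t s)
  have hsum : ∀ n, ∑ s, a n s = 1 := by
    intro n
    induction n with
    | zero => simp [ha0]
    | succ n ih =>
      simp only [ha]
      rw [Finset.sum_comm]
      simpa [← Finset.mul_sum, hq1] using ih
  -- The expected number of visits is the least nonnegative solution of the flow equation; `Y` may
  -- exceed it by circulations.
  have hcum : ∀ n, ∀ s ∈ X, ∑ k ∈ Finset.range (n + 1), a k s ≤ Y s := by
    intro n
    induction n with
    | zero =>
      intro s hs
      have h1 := hflow s
      rw [hβX s hs, add_zero] at h1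
      rw [Finset.sum_range_one, ha0, h1]
      exact le_add_of_nonneg_right (Finset.sum_nonneg fun t _ => mul_nonneg (hY t) (hq0 t s))
    | succ n ih =>
      intro s hs
      have h1 := hflow s
      rw [hβX s hs, add_zero] at h1
      rw [Finset.sum_range_succ', ha0, add_comm, h1]
      refine add_le_add_right ?_ _
      simp only [ha]
      rw [Finset.sum_comm]
      refine Finset.sum_le_sum fun t _ => ?_
      rw [← Finset.sum_mul]
      by_cases ht : t ∈ X
      · exact mul_le_mul_of_nonneg_right (ih t ht) (hq0 t s)
      · rw [hX t ht s hs, mul_zero, mul_zero]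
  -- Both sides equal `g s₀` plus the mass released from `X` weighted by `g`, counted with the
  -- actual visits on the left and with `Y` on the right.
  have hbound : ∀ g : S → ℝ, 0 ≤ g → (∀ s ∈ X, g s = 0) → (∀ t ∉ X, ∑ s, q t s * g s = g t) →
      ∀ n, ∑ s, a n s * g s ≤ ∑ s, β s * g s := by
    intro g hg hgX hharm n
    have hqg : ∀ t, 0 ≤ ∑ s, q t s * g s := fun t =>
      Finset.sum_nonneg fun s _ => mul_nonneg (hq0 t s) (hg s)
    have h1 : ∀ n, ∑ s, a n s * g s = g s₀ + ∑ k ∈ Finset.range n,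
        ∑ t, (if t ∈ X then a k t * ∑ s, q t s * g s else 0) := by
      intro n
      induction n with
      | zero => simp [ha0, Pi.single_apply]
      | succ n ih =>
        rw [Finset.sum_range_succ, ← add_assoc, ← ih, ← Finset.sum_add_distrib]
        simp only [ha, Finset.sum_mul]
        rw [Finset.sum_comm]
        refine Finset.sum_congr rfl fun t _ => ?_
        simp only [mul_assoc]
        rw [← Finset.mul_sum]
        by_cases ht : t ∈ X
        · simp [ht, hgX t ht]
        · simp [ht, hharm t ht]
    have h2 : ∑ s, β s * g s = g s₀ + ∑ t, Y t * ∑ s, q t s * g s := by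
      have h3 : ∀ s, β s * g s
          = (Pi.single s₀ 1 : S → ℝ) s * g s + (∑ t, Y t * q t s) * g s := by
        intro s
        have h := hflow s
        by_cases hs : s ∈ X
        · simp [hgX s hs]
        · rw [hYX s hs, zero_add] at h
          rw [h, add_mul]
      simp only [h3, Finset.sum_add_distrib, Finset.sum_mul]
      congr 1
      · simp [Pi.single_apply]
      · rw [Finset.sum_comm]
        simp [Finset.mul_sum, mul_assoc]
    rw [h1, h2, Finset.sum_comm]
    refine add_le_add_right (Finset.sum_le_sum fun t _ => ?_) _
    by_cases ht : t ∈ X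
    · simp only [ht, if_true, ← Finset.sum_mul]
      refine mul_le_mul_of_nonneg_right ?_ (hqg t)
      refine le_trans ?_ (hcum n t ht)
      rw [Finset.sum_range_succ]
      exact le_add_of_nonneg_right (hann n t)
    · simp [ht, hYX t ht]
  have hqc : ∀ t ∉ X, ∑ s, q t s * (Pi.single c 1 : S → ℝ) s = (Pi.single c 1 : S → ℝ) t := by
    intro t ht
    have hval : ∑ s, q t s * (Pi.single c 1 : S → ℝ) s = q t c := by simp [Pi.single_apply]
    rw [hval]
    by_cases htc : t = c
    · rw [htc, hcc1, Pi.single_eq_same]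
    · rw [hcc t ht htc, Pi.single_eq_of_ne htc]
  -- The bound for the point mass at `c` limits `a n c` from above; the bound for this complementary
  -- function, together with total mass `1`, limits it from below up to the mass still in `X`. That
  -- excess of `Y` is harmless follows from this comparison.
  set g : S → ℝ := fun s => (if s ∈ X then 0 else 1) - (Pi.single c 1 : S → ℝ) s with hg
  have hup : ∀ n, a n c ≤ β c := by
    intro n
    have := hbound (Pi.single c 1) (Pi.single_nonneg.2 zero_le_one)
      (fun s hs => Pi.single_eq_of_ne (fun h => hc (by rw [← h]; exact hs)) 1) hqc n
    simpa [Pi.single_apply] using this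
  have hlow : ∀ n, β c - ∑ s, (if s ∈ X then a n s else 0) ≤ a n c := by
    intro n
    have h1 := hbound g (fun s => by
        by_cases hs : s = c
        · subst hs; simp [hg, hc]
        · simp only [hg, Pi.single_eq_of_ne hs, sub_zero, Pi.zero_apply]
          split_ifs <;> simp)
      (fun s hs => by
        have : s ≠ c := fun h => hc (by rw [← h]; exact hs)
        simp [hg, hs, Pi.single_eq_of_ne this])
      (fun t ht => by
        simp only [hg, mul_sub, Finset.sum_sub_distrib, hqc t ht, ht, if_false]
        congr 1
        refine Eq.trans (Finset.sum_congr rfl fun s _ => ?_) (hq1 t)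
        by_cases hs : s ∈ X
        · simp [hs, hX t ht s hs]
        · simp [hs]) n
    have h2 : ∑ s, a n s * g s = 1 - (∑ s, if s ∈ X then a n s else 0) - a n c := by
      rw [← hsum n, ← Finset.sum_sub_distrib]
      simp only [hg, mul_sub, Finset.sum_sub_distrib]
      congr 1
      · rw [← Finset.sum_sub_distrib]
        refine Finset.sum_congr rfl fun s _ => ?_
        split_ifs <;> simp
      · simp [Pi.single_apply]
    have h3 : ∑ s, β s * g s = 1 - β c := by
      rw [← hβ1]
      simp only [hg, mul_sub, Finset.sum_sub_distrib]
      congr 1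
      · refine Finset.sum_congr rfl fun s _ => ?_
        split_ifs with hs
        · simp [hβX s hs]
        · simp
      · simp [Pi.single_apply]
    linarith
  -- The masses in `X` are summable over time, with sum at most `∑ s, Y s`.
  have hzero : Filter.Tendsto (fun n => ∑ s, (if s ∈ X then a n s else 0)) Filter.atTop
      (nhds 0) := by
    refine Summable.tendsto_atTop_zero (summable_of_sum_range_le (c := ∑ s, Y s)
      (fun n => Finset.sum_nonneg fun s _ => ?_) fun n => ?_)
    · split_ifs
      · exact hann n s
      · exact le_rfl
    · rw [Finset.sum_comm]
      refine Finset.sum_le_sum fun s _ => ?_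
      by_cases hs : s ∈ X
      · simp only [hs, if_true]
        refine le_trans ?_ (hcum n s hs)
        rw [Finset.sum_range_succ]
        exact le_add_of_nonneg_right (hann n s)
      · simpa [hs] using hY s
  refine tendsto_of_tendsto_of_tendsto_of_le_of_le ?_ tendsto_const_nhds hlow hup
  simpa using tendsto_const_nhds.sub hzero

/-! ### From a balance to a memoryless scheduler -/

namespace MDP

variable {S Act : Type*} [Fintype S]

open Classical in
/-- The probabilities of the actions under a distribution over the actions enabled in `s`. -/
noncomputable def actProb (M : MDP S Act) {s : S} (p : PMF (M.EnabledAct s)) (α : Act) : ℝ :=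
  if h : M.Enabled s α then (p ⟨α, h⟩).toReal else 0

theorem actProb_nonneg (M : MDP S Act) {s : S} (p : PMF (M.EnabledAct s)) (α : Act) :
    0 ≤ M.actProb p α := by
  unfold actProb
  split_ifs
  · exact ENNReal.toReal_nonneg
  · exact le_rfl

theorem enabled_of_actProb_ne_zero (M : MDP S Act) {s : S} {p : PMF (M.EnabledAct s)} {α : Act}
    (h : M.actProb p α ≠ 0) : M.Enabled s α := by
  by_contra hα
  exact h (dif_neg hα)

variable [Fintype Act]

theorem sum_actProb_mul (M : MDP S Act) {s : S} [Fintype (M.EnabledAct s)]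
    (p : PMF (M.EnabledAct s)) (f : Act → ℝ) :
    ∑ α, M.actProb p α * f α = ∑ α : M.EnabledAct s, (p α).toReal * f α.1 := by
  classical
  have h1 : ∀ α : M.EnabledAct s, (p α).toReal = M.actProb p α.1 := fun α => by
    rw [actProb, dif_pos α.2]
  simp only [h1]
  symm
  refine Finset.sum_of_injOn Subtype.val Subtype.val_injective.injOn (by simp) ?_ (by simp)
  intro α _ hα
  have : ¬ M.Enabled s α := fun h => hα ⟨⟨α, h⟩, by simp⟩
  simp [actProb, this]

theorem sum_actProb (M : MDP S Act) {s : S} (p : PMF (M.EnabledAct s)) :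
    ∑ α, M.actProb p α = 1 := by
  classical
  have h := M.sum_actProb_mul p 1
  simp only [Pi.one_apply, mul_one] at h
  rw [h, ← ENNReal.toReal_sum fun α _ => p.apply_ne_top α, ← tsum_fintype (L := .unconditional _),
    p.tsum_coe, ENNReal.toReal_one]

theorem exists_actProb_eq (M : MDP S Act) {s : S} {w : Act → ℝ} (h0 : 0 ≤ w) (h1 : ∑ α, w α = 1)
    (hw : ∀ α, w α ≠ 0 → M.Enabled s α) : ∃ p : PMF (M.EnabledAct s), M.actProb p = w := by
  classical
  refine ⟨PMF.ofFintype (fun α => ENNReal.ofReal (w α.1)) ?_, ?_⟩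
  · rw [← ENNReal.ofReal_sum_of_nonneg fun α _ => h0 α.1, ← ENNReal.ofReal_one, ← h1]
    congr 1
    refine Finset.sum_of_injOn Subtype.val Subtype.val_injective.injOn (by simp) ?_ (by simp)
    intro α _ hα
    by_contra h
    exact hα ⟨⟨α, hw α h⟩, by simp⟩
  · ext α
    unfold actProb
    split_ifs with h
    · simp [ENNReal.toReal_ofReal (h0 α)]
    · by_contra h'
      exact h (hw α (Ne.symm h'))

open Classical in
/-- The transition matrix of a memoryless scheduler, stopped in `D` and in terminal states. -/
noncomputable def stopMatrix (M : MDP S Act) (D : Set S)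
    (σ : (s : S) → ¬ M.IsTerminal s → PMF (M.EnabledAct s)) (t s : S) : ℝ :=
  if t ∈ D then (Pi.single t 1 : S → ℝ) s
  else if h : M.IsTerminal t then (Pi.single t 1 : S → ℝ) s
  else ∑ α, M.actProb (σ t h) α * M.P t α s

theorem stopMatrix_nonneg (M : MDP S Act) (D : Set S)
    (σ : (s : S) → ¬ M.IsTerminal s → PMF (M.EnabledAct s)) (t s : S) :
    0 ≤ M.stopMatrix D σ t s := by
  classical
  have h : 0 ≤ (Pi.single t 1 : S → ℝ) s :=
    (Pi.single_nonneg.2 zero_le_one : (0 : S → ℝ) ≤ Pi.single t 1) s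
  unfold stopMatrix
  split_ifs
  · exact h
  · exact h
  · exact Finset.sum_nonneg fun α _ => mul_nonneg (M.actProb_nonneg _ α) (NNReal.coe_nonneg _)

theorem sum_stopMatrix (M : MDP S Act) (D : Set S)
    (σ : (s : S) → ¬ M.IsTerminal s → PMF (M.EnabledAct s)) (t : S) :
    ∑ s, M.stopMatrix D σ t s = 1 := by
  classical
  unfold stopMatrix
  split_ifs with h1 h2
  · simp
  · simp
  · rw [Finset.sum_comm, ← M.sum_actProb (σ t h2)]
    refine Finset.sum_congr rfl fun α _ => ?_
    rw [← Finset.mul_sum]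
    by_cases h : M.actProb (σ t h2) α = 0
    · simp [h]
    · rw [M.sum_coe_P (M.enabled_of_actProb_ne_zero h), mul_one]

-- Choose actions in proportion to the flow `y` where some mass flows out. Where nothing flows out
-- the choice is free, and in `Z` it is used to stay in `Z`. The flow equation for `y` then becomes
-- the stationary equation of the induced chain, with all of `T ∪ Z` as sink.
open Classical in
theorem IsBalance.exists_memoryless {M : MDP S Act} {T Z : Set S} {s₀ : S} {y : S × Act → ℝ}
    {β : S → ℝ} (h : M.IsBalance T Z s₀ y β) (hZ : M.SafeClosed T Z)
    (hβ : ∀ s ∉ T ∪ Z, β s = 0) :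
    ∃ σ : (s : S) → ¬ M.IsTerminal s → PMF (M.EnabledAct s), ∀ a : ℕ → S → ℝ,
      a 0 = Pi.single s₀ 1 → (∀ n s, a (n + 1) s = ∑ t, a n t * M.stopMatrix T σ t s) →
      ∀ c ∈ T, Filter.Tendsto (fun n => a n c) Filter.atTop (nhds (β c)) := by
  set Y : S → ℝ := fun s => ∑ α, y (s, α) with hY
  have hY0 : 0 ≤ Y := fun s => Finset.sum_nonneg fun α _ => h.flow.nonneg _
  have hYX : ∀ s ∈ T ∪ Z, ∀ α, y (s, α) = 0 := fun s hs α => by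
    by_contra hne
    exact (h.flow.supp _ hne).1 hs
  have hσ : ∀ s, ∀ hs : ¬ M.IsTerminal s, ∃ p : PMF (M.EnabledAct s),
      (s ∈ Z → ∀ α t, M.actProb p α ≠ 0 → M.P s α t ≠ 0 → t ∈ Z) ∧
      ∀ α, Y s * M.actProb p α = y (s, α) := by
    intro s hs
    by_cases hsY : Y s = 0
    · have hy0 : ∀ α, y (s, α) = 0 := fun α =>
        (Finset.sum_eq_zero_iff_of_nonneg fun α _ => h.flow.nonneg (s, α)).1 hsY α (Finset.mem_univ α)
      have hex : ∃ α, M.Enabled s α ∧ (s ∈ Z → ∀ t, M.P s α t ≠ 0 → t ∈ Z) := by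
        by_cases hsZ : s ∈ Z
        · obtain ⟨α, hα, hα'⟩ := (hZ s hsZ).2.resolve_left hs
          exact ⟨α, hα, fun _ => hα'⟩
        · obtain ⟨α, hα⟩ : ∃ α, M.Enabled s α := by simpa [IsTerminal] using hs
          exact ⟨α, hα, fun h' => absurd h' hsZ⟩
      obtain ⟨α, hα, hα'⟩ := hex
      obtain ⟨p, hp⟩ := M.exists_actProb_eq (s := s) (w := Pi.single α 1)
        (Pi.single_nonneg.2 zero_le_one) (by simp) (fun α' hne => by
          have : α' = α := by
            by_contra h'
            exact hne (Pi.single_eq_of_ne h' _)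
          exact this ▸ hα)
      refine ⟨p, fun hsZ α' t hne => ?_, fun α' => by rw [hsY, hy0, zero_mul]⟩
      have : α' = α := by
        by_contra h'
        exact hne (by rw [hp]; exact Pi.single_eq_of_ne h' _)
      rw [this]
      exact hα' hsZ t
    · obtain ⟨p, hp⟩ := M.exists_actProb_eq (s := s) (w := fun α => y (s, α) / Y s)
        (fun α => div_nonneg (h.flow.nonneg _) (hY0 s))
        (by rw [← Finset.sum_div]; exact div_self hsY)
        (fun α hne => (h.flow.supp (s, α) fun h' => hne (by simp [h'])).2)
      refine ⟨p, fun hsZ => absurd ?_ hsY, fun α => ?_⟩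
      · exact Finset.sum_eq_zero fun α _ => hYX s (Or.inr hsZ) α
      · rw [hp]
        exact mul_div_cancel₀ _ hsY
  choose σ hσZ hσY using hσ
  refine ⟨σ, fun a ha0 ha c hc => ?_⟩
  have hZT : ∀ s ∈ Z, s ∉ T := fun s hs hT => (hZ s hs).1 (.base s hT)
  have hkept : ∀ t ∈ T ∪ Z, ∀ s, s ∉ Z → s ≠ t → M.stopMatrix T σ t s = 0 := by
    intro t ht s hs hst
    unfold stopMatrix
    split_ifs with h1 h2
    · exact Pi.single_eq_of_ne hst _
    · exact Pi.single_eq_of_ne hst _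
    · refine Finset.sum_eq_zero fun α _ => ?_
      by_contra hne
      have h3 : M.P t α s ≠ 0 := fun h' => hne (by simp [h'])
      exact hs (hσZ t h2 (ht.resolve_left h1) α s (left_ne_zero_of_mul hne) h3)
  refine tendsto_absorption (q := M.stopMatrix T σ) (X := (T ∪ Z)ᶜ) (Y := Y) (s₀ := s₀)
    (M.stopMatrix_nonneg T σ) (M.sum_stopMatrix T σ) ?_ hY0 (fun s hs => hβ s hs) ?_
    h.sum_eq_one ?_ ha0 ha ?_ (by simp [stopMatrix, hc]) ?_
  · intro t ht s hs
    rw [Set.notMem_compl_iff] at ht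
    exact hkept t ht s (fun h' => hs (Or.inr h')) fun h' => hs (h' ▸ ht)
  · intro s hs
    rw [Set.notMem_compl_iff] at hs
    exact Finset.sum_eq_zero fun α _ => hYX s hs α
  · intro s
    have h1 : ∀ t, Y t * M.stopMatrix T σ t s = ∑ α, y (t, α) * M.P t α s := by
      intro t
      by_cases ht : t ∈ T
      · have h2 : Y t = 0 := Finset.sum_eq_zero fun α _ => hYX t (Or.inl ht) α
        simp [h2, hYX t (Or.inl ht)]
      · by_cases hterm : M.IsTerminal t
        · have h2 : ∀ α, y (t, α) = 0 := fun α => by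
            by_contra hne
            exact hterm α (h.flow.supp _ hne).2
          simp [hY, h2]
        · rw [stopMatrix, if_neg ht, dif_neg hterm, Finset.mul_sum]
          exact Finset.sum_congr rfl fun α _ => by rw [← mul_assoc, hσY]
    simp only [h1]
    rw [h.eq, Pi.add_apply, netFlow_apply, Fintype.sum_prod_type]
    simp only [mul_sub, Finset.sum_sub_distrib]
    have h2 : ∑ t, ∑ α, y (t, α) * (Pi.single t 1 : S → ℝ) s = Y s := by
      rw [Finset.sum_eq_single s]
      · simp [hY]
      · intro t _ hts
        simp [Pi.single_eq_of_ne hts.symm]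
      · simp
    rw [h2]
    ring
  · exact fun h' => h' (Or.inl hc)
  · intro t ht htc
    rw [Set.notMem_compl_iff] at ht
    exact hkept t ht c (fun h' => hZT c h' hc) htc.symm

end MDP

/-! ### Sets of paths closed under prolongation -/

namespace FinPath

variable {S Act : Type*}

instance : DiscreteMeasurableSpace (FinPath S Act) := ⟨fun _ => trivial⟩

instance [Finite S] [Finite Act] : Countable (FinPath S Act) := by
  have h : Function.Injective fun π : FinPath S Act => (π.hist, π.last) := fun π π' h => by
    rw [Prod.mk.injEq] at h
    exact FinPath.ext h.1 h.2
  exact h.countable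

/-- The sets of paths that are closed under prolongation. -/
def Persistent (A : Set (FinPath S Act)) : Prop := ∀ π ∈ A, ∀ α t, π.extend α t ∈ A

/-- The set of paths that contain a state of `T`. -/
def visits (Act : Type*) (T : Set S) : Set (FinPath S Act) :=
  {π | π.last ∈ T ∨ ∃ x ∈ π.hist, x.1 ∈ T}

theorem extend_mem_visits {T : Set S} {π : FinPath S Act} {α : Act} {t : S} :
    π.extend α t ∈ visits Act T ↔ t ∈ T ∨ π ∈ visits Act T := by
  simp only [visits, extend, Set.mem_ofPred_eq, List.mem_append, List.mem_singleton]
  constructor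
  · rintro (h | ⟨x, h | rfl, hx⟩)
    · exact Or.inl h
    · exact Or.inr (Or.inr ⟨x, h, hx⟩)
    · exact Or.inr (Or.inl hx)
  · rintro (h | h | ⟨x, h, hx⟩)
    · exact Or.inl h
    · exact Or.inr ⟨_, Or.inr rfl, h⟩
    · exact Or.inr ⟨x, Or.inl h, hx⟩

theorem persistent_visits (T : Set S) : Persistent (visits Act T) :=
  fun _ hπ _ _ => extend_mem_visits.2 (Or.inr hπ)

theorem Persistent.inter {A B : Set (FinPath S Act)} (hA : Persistent A) (hB : Persistent B) :
    Persistent (A ∩ B) := fun π hπ α t => ⟨hA π hπ.1 α t, hB π hπ.2 α t⟩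

end FinPath

/-! ### The one-step expectation operator and its link with the path measure -/

namespace MDP

variable {S Act : Type*} [Fintype S]

open Classical in
/-- The probability that the scheduler chooses the action `α` after the path `π`. -/
noncomputable def prob (M : MDP S Act) (𝔖 : M.Scheduler) (π : FinPath S Act) (α : Act) : ℝ :=
  if h : M.IsTerminal π.last then 0 else M.actProb (𝔖.choice π h) α

theorem prob_nonneg (M : MDP S Act) (𝔖 : M.Scheduler) (π : FinPath S Act) (α : Act) :
    0 ≤ M.prob 𝔖 π α := by
  unfold prob
  split_ifs
  · exact le_rfl
  · exact M.actProb_nonneg _ _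

theorem enabled_of_prob_ne_zero {M : MDP S Act} {𝔖 : M.Scheduler} {π : FinPath S Act} {α : Act}
    (h : M.prob 𝔖 π α ≠ 0) : M.Enabled π.last α := by
  unfold prob at h
  split_ifs at h with h'
  · exact absurd rfl h
  · exact M.enabled_of_actProb_ne_zero h

variable [Fintype Act]

open Classical in
/-- The one-step expectation of a function of paths; paths that end in `D` or in a terminal
state are kept. -/
noncomputable def run (M : MDP S Act) (𝔖 : M.Scheduler) (D : Set S) (g : FinPath S Act → ℝ)
    (π : FinPath S Act) : ℝ :=
  if π.last ∈ D ∨ M.IsTerminal π.last then g π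
  else ∑ α, M.prob 𝔖 π α * ∑ t, M.P π.last α t * g (π.extend α t)

section run

variable {M : MDP S Act} {𝔖 : M.Scheduler} {D : Set S} {f g : FinPath S Act → ℝ}
  {π : FinPath S Act}

theorem sum_prob (h : ¬ M.IsTerminal π.last) : ∑ α, M.prob 𝔖 π α = 1 := by
  simp only [prob, h, dif_neg, not_false_iff]
  exact M.sum_actProb _

theorem run_of_stop (h : π.last ∈ D ∨ M.IsTerminal π.last) : M.run 𝔖 D g π = g π := if_pos h

theorem run_of_not_stop (h : π.last ∉ D) (h' : ¬ M.IsTerminal π.last) :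
    M.run 𝔖 D g π = ∑ α, M.prob 𝔖 π α * ∑ t, M.P π.last α t * g (π.extend α t) :=
  if_neg (not_or.2 ⟨h, h'⟩)

theorem iterate_run_of_stop (h : π.last ∈ D ∨ M.IsTerminal π.last) (n : ℕ) :
    (M.run 𝔖 D)^[n] g π = g π := by
  induction n with
  | zero => rfl
  | succ n ih => rw [Function.iterate_succ_apply', run_of_stop h, ih]

theorem run_const (c : ℝ) : M.run 𝔖 D (fun _ => c) = fun _ => c := by
  ext π
  by_cases h : π.last ∈ D ∨ M.IsTerminal π.last
  · rw [run_of_stop h]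
  · rw [not_or] at h
    rw [run_of_not_stop h.1 h.2]
    calc ∑ α, M.prob 𝔖 π α * ∑ t, M.P π.last α t * c = ∑ α, M.prob 𝔖 π α * c := by
          refine Finset.sum_congr rfl fun α _ => ?_
          by_cases hα : M.prob 𝔖 π α = 0
          · simp [hα]
          · rw [← Finset.sum_mul, M.sum_coe_P (enabled_of_prob_ne_zero hα), one_mul]
      _ = c := by rw [← Finset.sum_mul, sum_prob h.2, one_mul]

theorem iterate_run_const (c : ℝ) (n : ℕ) : (M.run 𝔖 D)^[n] (fun _ => c) = fun _ => c :=
  Function.iterate_fixed (run_const c) n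

theorem run_add : M.run 𝔖 D (f + g) = M.run 𝔖 D f + M.run 𝔖 D g := by
  ext π
  unfold run
  simp only [Pi.add_apply]
  split_ifs
  · rfl
  · simp only [mul_add, Finset.sum_add_distrib]

theorem run_smul (c : ℝ) : M.run 𝔖 D (c • g) = c • M.run 𝔖 D g := by
  ext π
  unfold run
  simp only [Pi.smul_apply, smul_eq_mul]
  split_ifs
  · rfl
  · simp only [Finset.mul_sum]
    exact Finset.sum_congr rfl fun α _ => Finset.sum_congr rfl fun t _ => by ring

/-- The one-step expectation as a linear map. -/
noncomputable def runLin (M : MDP S Act) (𝔖 : M.Scheduler) (D : Set S) :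
    (FinPath S Act → ℝ) →ₗ[ℝ] (FinPath S Act → ℝ) where
  toFun := M.run 𝔖 D
  map_add' _ _ := run_add
  map_smul' c _ := run_smul c

theorem iterate_run_eq (M : MDP S Act) (𝔖 : M.Scheduler) (D : Set S) (n : ℕ) :
    (M.run 𝔖 D)^[n] = ⇑(M.runLin 𝔖 D ^ n) := (Module.End.coe_pow (M.runLin 𝔖 D) n).symm

theorem run_mono_on {A : Set (FinPath S Act)} (hA : FinPath.Persistent A)
    (h : ∀ π ∈ A, f π ≤ g π) (hπ : π ∈ A) : M.run 𝔖 D f π ≤ M.run 𝔖 D g π := by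
  unfold run
  split_ifs
  · exact h π hπ
  · exact Finset.sum_le_sum fun α _ => mul_le_mul_of_nonneg_left (Finset.sum_le_sum fun t _ =>
      mul_le_mul_of_nonneg_left (h _ (hA π hπ α t)) (NNReal.coe_nonneg _)) (M.prob_nonneg 𝔖 π α)

theorem iterate_run_mono_on {A : Set (FinPath S Act)} (hA : FinPath.Persistent A)
    (h : ∀ π ∈ A, f π ≤ g π) (n : ℕ) :
    ∀ π ∈ A, (M.run 𝔖 D)^[n] f π ≤ (M.run 𝔖 D)^[n] g π := by
  induction n with
  | zero => exact h
  | succ n ih =>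
    intro π hπ
    rw [Function.iterate_succ_apply', Function.iterate_succ_apply']
    exact run_mono_on hA ih hπ

theorem iterate_run_congr_on {A : Set (FinPath S Act)} (hA : FinPath.Persistent A)
    (h : ∀ π ∈ A, f π = g π) (n : ℕ) (hπ : π ∈ A) :
    (M.run 𝔖 D)^[n] f π = (M.run 𝔖 D)^[n] g π :=
  le_antisymm (iterate_run_mono_on hA (fun π hπ => (h π hπ).le) n π hπ)
    (iterate_run_mono_on hA (fun π hπ => (h π hπ).ge) n π hπ)

theorem iterate_run_mono (h : f ≤ g) (n : ℕ) : (M.run 𝔖 D)^[n] f ≤ (M.run 𝔖 D)^[n] g :=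
  fun π => iterate_run_mono_on (A := Set.univ) (fun _ _ _ _ => trivial) (fun π _ => h π) n π trivial

theorem iterate_run_nonneg (h : 0 ≤ g) (n : ℕ) : 0 ≤ (M.run 𝔖 D)^[n] g := by
  have := iterate_run_mono (M := M) (𝔖 := 𝔖) (D := D) h n
  rwa [show (0 : FinPath S Act → ℝ) = fun _ => 0 from rfl, iterate_run_const] at this

end run

section measure

variable (M : MDP S Act) (𝔖 : M.Scheduler)

theorem lintegral_stepKernel {g : FinPath S Act → ℝ} (hg : 0 ≤ g) (π : FinPath S Act) :
    ∫⁻ π', ENNReal.ofReal (g π') ∂(M.stepKernel 𝔖 π) = ENNReal.ofReal (M.run 𝔖 ∅ g π) := by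
  classical
  change ∫⁻ π', ENNReal.ofReal (g π') ∂(M.step 𝔖 π).toMeasure = _
  by_cases h : M.IsTerminal π.last
  · rw [run_of_stop (Or.inr h), step, dif_pos h, PMF.toMeasure_pure, lintegral_dirac]
  · rw [run_of_not_stop (Set.notMem_empty _) h]
    have hmeas : (M.step 𝔖 π).toMeasure = ∑ α, 𝔖.choice π h α •
        ∑ t, (M.P π.last α.1 t : ℝ≥0∞) • Measure.dirac (π.extend α.1 t) := by
      let _ : MeasurableSpace S := ⊤
      refine Measure.ext fun A _ => ?_
      rw [step, dif_neg h, PMF.toMeasure_bind_apply _ _ _ (.of_discrete), tsum_fintype]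
      simp only [Measure.finsetSum_apply, Measure.smul_apply, smul_eq_mul]
      refine Finset.sum_congr rfl fun α _ => ?_
      rw [PMF.toMeasure_map_apply _ _ _ measurable_from_top (.of_discrete),
        PMF.toMeasure_apply_fintype]
      congr 1
      refine Finset.sum_congr rfl fun t _ => ?_
      rw [Measure.dirac_apply' _ (.of_discrete)]
      by_cases ht : π.extend α.1 t ∈ A <;> simp [ht, next, Set.indicator]
    have hr : ∀ α : Act, 0 ≤ ∑ t, (M.P π.last α t : ℝ) * g (π.extend α t) := fun α =>
      Finset.sum_nonneg fun t _ => mul_nonneg (NNReal.coe_nonneg _) (hg _)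
    have hprob : M.prob 𝔖 π = M.actProb (𝔖.choice π h) := by
      ext α
      rw [prob, dif_neg h]
    rw [hmeas, hprob, sum_actProb_mul, lintegral_finsetSum_measure, ENNReal.ofReal_sum_of_nonneg
      fun α _ => mul_nonneg ENNReal.toReal_nonneg (hr α.1)]
    refine Finset.sum_congr rfl fun α _ => ?_
    rw [lintegral_smul_measure, lintegral_finsetSum_measure,
      ENNReal.ofReal_mul ENNReal.toReal_nonneg, ENNReal.ofReal_toReal (PMF.apply_ne_top _ _),
      ENNReal.ofReal_sum_of_nonneg fun t _ => mul_nonneg (NNReal.coe_nonneg _) (hg _), smul_eq_mul]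
    congr 1
    refine Finset.sum_congr rfl fun t _ => ?_
    rw [lintegral_smul_measure, lintegral_dirac, ENNReal.ofReal_mul (NNReal.coe_nonneg _),
      ENNReal.ofReal_coe_nnreal, smul_eq_mul]

/-- The Markov property, read off from the finite-dimensional marginals of `Kernel.traj`. -/
theorem lintegral_Pr_succ (s : S) (n : ℕ) (F : FinPath S Act × FinPath S Act → ℝ≥0∞) :
    ∫⁻ ω, F (ω n, ω (n + 1)) ∂(M.Pr 𝔖 s)
      = ∫⁻ ω, ∫⁻ π', F (ω n, π') ∂(M.stepKernel 𝔖 (ω n)) ∂(M.Pr 𝔖 s) := by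
  have hF : Measurable F := measurable_of_countable F
  set κ : (n : ℕ) → Kernel (Π _ : Finset.Iic n, FinPath S Act) (FinPath S Act) :=
    fun n => (M.stepKernel 𝔖).comap (fun x : (Π _ : Finset.Iic n, FinPath S Act) =>
      x ⟨n, Finset.mem_Iic.2 le_rfl⟩) (measurable_pi_apply _) with hκ
  have hPr : M.Pr 𝔖 s = Kernel.traj (X := fun _ => FinPath S Act) κ 0
    (fun _ => FinPath.start s) := rfl
  have hpair := Kernel.partialTraj_compProd_eq_map_traj (X := fun _ => FinPath S Act) (κ := κ)
    (Nat.zero_le n) (x₀ := fun _ => FinPath.start s)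
  have hmar := Kernel.traj_map_frestrictLe_apply (X := fun _ => FinPath S Act) (κ := κ)
    0 n (fun _ => FinPath.start s)
  have hG : Measurable fun x : (Π _ : Finset.Iic n, FinPath S Act) × FinPath S Act =>
      F (x.1 ⟨n, Finset.mem_Iic.2 le_rfl⟩, x.2) :=
    hF.comp ((measurable_pi_apply _).comp measurable_fst |>.prodMk measurable_snd)
  calc ∫⁻ ω, F (ω n, ω (n + 1)) ∂(M.Pr 𝔖 s)
      = ∫⁻ x, F (x.1 ⟨n, Finset.mem_Iic.2 le_rfl⟩, x.2) ∂((M.Pr 𝔖 s).map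
          fun x => (Preorder.frestrictLe n x, x (n + 1))) := by
        rw [lintegral_map hG (by fun_prop)]
        rfl
    _ = ∫⁻ x, ∫⁻ π', F (x ⟨n, Finset.mem_Iic.2 le_rfl⟩, π')
          ∂(κ n x) ∂((M.Pr 𝔖 s).map (Preorder.frestrictLe n)) := by
        rw [hPr, ← hpair, hmar, Measure.lintegral_compProd hG]
    _ = _ := by
        rw [lintegral_map hG.lintegral_kernel_prod_right' (by fun_prop)]
        rfl

theorem ae_zero (s : S) : ∀ᵐ ω ∂(M.Pr 𝔖 s), ω 0 = FinPath.start s := by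
  set κ : (n : ℕ) → Kernel (Π _ : Finset.Iic n, FinPath S Act) (FinPath S Act) :=
    fun n => (M.stepKernel 𝔖).comap (fun x : (Π _ : Finset.Iic n, FinPath S Act) =>
      x ⟨n, Finset.mem_Iic.2 le_rfl⟩) (measurable_pi_apply _) with hκ
  have hPr : M.Pr 𝔖 s = Kernel.traj (X := fun _ => FinPath S Act) κ 0
    (fun _ => FinPath.start s) := rfl
  have hmar := Kernel.traj_map_frestrictLe_apply (X := fun _ => FinPath S Act) (κ := κ)
    0 0 (fun _ => FinPath.start s)
  rw [Kernel.partialTraj_self, Kernel.id_apply] at hmar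
  have h : ∀ᵐ x ∂((M.Pr 𝔖 s).map (Preorder.frestrictLe 0)),
      x ⟨0, Finset.mem_Iic.2 le_rfl⟩ = FinPath.start s := by
    rw [hPr, hmar, ae_dirac_iff]
    exact (measurable_pi_apply _) (MeasurableSet.singleton _)
  exact ae_of_ae_map (by fun_prop) h

theorem lintegral_Pr {g : FinPath S Act → ℝ} (hg : 0 ≤ g) (s : S) (n : ℕ) :
    ∫⁻ ω, ENNReal.ofReal (g (ω n)) ∂(M.Pr 𝔖 s)
      = ENNReal.ofReal ((M.run 𝔖 ∅)^[n] g (FinPath.start s)) := by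
  induction n generalizing g with
  | zero =>
    rw [lintegral_congr_ae (g := fun _ => ENNReal.ofReal (g (FinPath.start s)))]
    · simp
    · filter_upwards [M.ae_zero 𝔖 s] with ω hω
      rw [hω]
  | succ n ih =>
    rw [M.lintegral_Pr_succ 𝔖 s n fun x => ENNReal.ofReal (g x.2)]
    simp only [M.lintegral_stepKernel 𝔖 hg]
    rw [ih (g := M.run 𝔖 ∅ g) (iterate_run_nonneg hg 1), Function.iterate_succ_apply]

theorem ae_succ (s : S) : ∀ᵐ ω ∂(M.Pr 𝔖 s), ∀ n, ω (n + 1) = ω n ∨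
    ∃ α t, ω (n + 1) = (ω n).extend α t := by
  classical
  rw [ae_all_iff]
  intro n
  set R : Set (FinPath S Act × FinPath S Act) := {x | ¬ (x.2 = x.1 ∨ ∃ α t, x.2 = x.1.extend α t)}
  have hR : ∀ π, ∫⁻ π', R.indicator (1 : FinPath S Act × FinPath S Act → ℝ≥0∞) (π, π')
      ∂(M.stepKernel 𝔖 π) = 0 := by
    intro π
    have h1 : ∀ π', R.indicator (1 : FinPath S Act × FinPath S Act → ℝ≥0∞) (π, π')
        = ENNReal.ofReal (R.indicator (1 : FinPath S Act × FinPath S Act → ℝ) (π, π')) := by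
      intro π'
      by_cases h : (π, π') ∈ R <;> simp [h]
    simp only [h1]
    rw [M.lintegral_stepKernel 𝔖 (g := fun π' => R.indicator 1 (π, π'))
      (fun π' => Set.indicator_nonneg (fun _ _ => zero_le_one) _), ENNReal.ofReal_eq_zero]
    refine le_of_eq ?_
    unfold run
    split_ifs
    · simp [R]
    · refine Finset.sum_eq_zero fun α _ => ?_
      rw [Finset.sum_eq_zero, mul_zero]
      intro t _
      have : (π, π.extend α t) ∉ R := fun h => h (Or.inr ⟨α, t, rfl⟩)
      simp [this]
  have h := M.lintegral_Pr_succ 𝔖 s n (R.indicator 1)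
  simp only [hR, lintegral_zero] at h
  rw [lintegral_eq_zero_iff] at h
  · filter_upwards [h] with ω hω
    by_contra hcon
    have : (ω n, ω (n + 1)) ∈ R := hcon
    simp [this] at hω
  · exact (measurable_of_countable (R.indicator (1 : FinPath S Act × FinPath S Act → ℝ≥0∞))).comp
      ((measurable_pi_apply n).prodMk (measurable_pi_apply (n + 1)))

end measure

end MDP

/-! ### Reachability probabilities, residual schedulers and minimal reachability -/

namespace FinPath

variable {S Act : Type*}

/-- The concatenation of two paths, where the second one starts in the last state of the first. -/
def append (π π' : FinPath S Act) : FinPath S Act := ⟨π.hist ++ π'.hist, π'.last⟩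

theorem append_extend (π π' : FinPath S Act) (α : Act) (t : S) :
    (π.append π').extend α t = π.append (π'.extend α t) := by
  simp [append, extend, List.append_assoc]

end FinPath

namespace MDP

variable {S Act : Type*}

theorem indicator_one_le_one (A : Set (FinPath S Act)) (π : FinPath S Act) :
    A.indicator (1 : FinPath S Act → ℝ) π ≤ 1 :=
  Set.indicator_le_self' (fun _ _ => zero_le_one) π

theorem indicator_one_nonneg (A : Set (FinPath S Act)) :
    0 ≤ A.indicator (1 : FinPath S Act → ℝ) :=
  Set.indicator_nonneg fun _ _ => zero_le_one

theorem measurableSet_eventually (T : Set S) : MeasurableSet (eventually Act T) := by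
  have : eventually Act T = ⋃ j, {ω | ω j ∈ {π : FinPath S Act | π.last ∈ T}} := by
    ext ω
    simp [eventually, untilEvent]
  rw [this]
  exact MeasurableSet.iUnion fun j => measurable_pi_apply j (MeasurableSet.of_discrete)

variable [Fintype S]

/-- The minimal probability to reach `T`, as a real number. -/
noncomputable def minReach (M : MDP S Act) (T : Set S) (s : S) : ℝ :=
  (M.prMin s (eventually Act T)).toReal

theorem minReach_nonneg (M : MDP S Act) (T : Set S) (s : S) : 0 ≤ M.minReach T s :=
  ENNReal.toReal_nonneg

theorem minReach_le_one (M : MDP S Act) (T : Set S) (s : S) : M.minReach T s ≤ 1 :=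
  ENNReal.toReal_le_of_le_ofReal zero_le_one (by simpa using M.prMin_le_one s _)

/-- The scheduler that behaves like `𝔖` behaves after the path `π`. -/
def Scheduler.after {M : MDP S Act} (𝔖 : M.Scheduler) (π : FinPath S Act) : M.Scheduler :=
  ⟨fun π' h => 𝔖.choice (π.append π') h⟩

variable [Fintype Act]

/-- The probability to reach the set `A` of paths from the path `π`, if `A` is persistent. -/
noncomputable def reach (M : MDP S Act) (𝔖 : M.Scheduler) (A : Set (FinPath S Act))
    (π : FinPath S Act) : ℝ :=
  ⨆ n, (M.run 𝔖 ∅)^[n] (A.indicator 1) π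

section reach

variable {M : MDP S Act} {𝔖 : M.Scheduler} {D : Set S} {A B : Set (FinPath S Act)}
  {f g : FinPath S Act → ℝ} {π : FinPath S Act}

theorem monotone_iterate_run (h : g ≤ M.run 𝔖 D g) (π : FinPath S Act) :
    Monotone fun n => (M.run 𝔖 D)^[n] g π := by
  have hmono : Monotone (M.run 𝔖 D) := fun f g h => iterate_run_mono h 1
  exact fun m n hmn => hmono.monotone_iterate_of_le_map h hmn π

theorem iterate_run_le_of_le (c : ℝ) (h : ∀ π, g π ≤ c) (n : ℕ) (π : FinPath S Act) :
    (M.run 𝔖 D)^[n] g π ≤ c := by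
  have := iterate_run_mono (M := M) (𝔖 := 𝔖) (D := D) (f := g) (g := fun _ => c) h n π
  rwa [iterate_run_const] at this

theorem tendsto_iterate_run (h : g ≤ M.run 𝔖 D g) {c : ℝ} (hc : ∀ π, g π ≤ c)
    (π : FinPath S Act) :
    Filter.Tendsto (fun n => (M.run 𝔖 D)^[n] g π) Filter.atTop
      (nhds (⨆ n, (M.run 𝔖 D)^[n] g π)) :=
  tendsto_atTop_ciSup (monotone_iterate_run h π)
    ⟨c, by rintro _ ⟨n, rfl⟩; exact iterate_run_le_of_le c hc n π⟩

theorem iterate_run_indicator_of_mem (hA : FinPath.Persistent A) (hπ : π ∈ A) (n : ℕ) :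
    (M.run 𝔖 D)^[n] (A.indicator 1) π = 1 := by
  rw [iterate_run_congr_on hA (g := fun _ => 1) (fun π h => by simp [h]) n hπ, iterate_run_const]

theorem indicator_le_run (hA : FinPath.Persistent A) :
    A.indicator 1 ≤ M.run 𝔖 D (A.indicator 1) := by
  intro π
  by_cases hπ : π ∈ A
  · have := iterate_run_indicator_of_mem (M := M) (𝔖 := 𝔖) (D := D) hA hπ 1
    rw [Function.iterate_one] at this
    simp [hπ, this]
  · rw [Set.indicator_of_notMem hπ]
    exact iterate_run_nonneg (indicator_one_nonneg A) 1 π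

theorem tendsto_reach (hA : FinPath.Persistent A) (π : FinPath S Act) :
    Filter.Tendsto (fun n => (M.run 𝔖 ∅)^[n] (A.indicator 1) π) Filter.atTop
      (nhds (M.reach 𝔖 A π)) :=
  tendsto_iterate_run (indicator_le_run hA) (indicator_one_le_one A) π

theorem reach_nonneg (hA : FinPath.Persistent A) : 0 ≤ M.reach 𝔖 A π :=
  ge_of_tendsto' (tendsto_reach hA π) fun n => iterate_run_nonneg (indicator_one_nonneg A) n π

theorem reach_of_mem (hA : FinPath.Persistent A) (hπ : π ∈ A) : M.reach 𝔖 A π = 1 := by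
  refine tendsto_nhds_unique (tendsto_reach hA π) ?_
  simp only [iterate_run_indicator_of_mem hA hπ]
  exact tendsto_const_nhds

theorem reach_eq_sum (hA : FinPath.Persistent A) (h : ¬ M.IsTerminal π.last) :
    M.reach 𝔖 A π
      = ∑ α, M.prob 𝔖 π α * ∑ t, M.P π.last α t * M.reach 𝔖 A (π.extend α t) := by
  have h1 := (Filter.tendsto_add_atTop_iff_nat 1).2 (tendsto_reach (M := M) (𝔖 := 𝔖) hA π)
  refine tendsto_nhds_unique h1 ?_
  simp only [Function.iterate_succ_apply', run_of_not_stop (Set.notMem_empty _) h]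
  exact tendsto_finsetSum _ fun α _ => (tendsto_finsetSum _ fun t _ =>
    (tendsto_reach hA _).const_mul _).const_mul _

/-- Almost surely each entry repeats or prolongs the previous one, so for persistent `A` the events
of being in `A` at time `n` increase, and continuity from below applies. -/
theorem toReal_Pr_exists_mem (hA : FinPath.Persistent A) (s : S) :
    (M.Pr 𝔖 s {ω | ∃ j, ω j ∈ A}).toReal = M.reach 𝔖 A (FinPath.start s) := by
  have hmeas : ∀ n, MeasurableSet {ω : ℕ → FinPath S Act | ω n ∈ A} := fun n =>
    measurable_pi_apply n (MeasurableSet.of_discrete (s := A))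
  have h1 : ∀ n, M.Pr 𝔖 s {ω | ω n ∈ A}
      = ENNReal.ofReal ((M.run 𝔖 ∅)^[n] (A.indicator 1) (FinPath.start s)) := by
    intro n
    rw [← M.lintegral_Pr 𝔖 (indicator_one_nonneg A) s n, ← lintegral_indicator_one (hmeas n)]
    refine lintegral_congr fun ω => ?_
    by_cases h : ω n ∈ A <;> simp [h]
  have h2 : ∀ n, M.Pr 𝔖 s {ω | ∃ j ≤ n, ω j ∈ A} = M.Pr 𝔖 s {ω | ω n ∈ A} := by
    intro n
    refine measure_congr ?_
    filter_upwards [M.ae_succ 𝔖 s] with ω hω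
    refine propext ⟨?_, fun h => ⟨n, le_rfl, h⟩⟩
    rintro ⟨j, hj, hjA⟩
    induction hj with
    | refl => exact hjA
    | step _ ih =>
      rename_i m _
      change ω (m + 1) ∈ A
      rcases hω m with h | ⟨α, t, h⟩
      · rw [h]; exact ih
      · rw [h]; exact hA _ ih α t
  have h3 : {ω : ℕ → FinPath S Act | ∃ j, ω j ∈ A} = ⋃ n, {ω | ∃ j ≤ n, ω j ∈ A} := by
    ext ω
    simp only [Set.mem_ofPred_eq, Set.mem_iUnion]
    exact ⟨fun ⟨j, hj⟩ => ⟨j, j, le_rfl, hj⟩, fun ⟨_, j, _, hj⟩ => ⟨j, hj⟩⟩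
  have h4 : Filter.Tendsto (fun n => M.Pr 𝔖 s {ω | ∃ j ≤ n, ω j ∈ A}) Filter.atTop
      (nhds (M.Pr 𝔖 s {ω | ∃ j, ω j ∈ A})) := by
    rw [h3]
    exact tendsto_measure_iUnion_atTop fun m n hmn ω ⟨j, hj, h⟩ => ⟨j, hj.trans hmn, h⟩
  have h5 := (ENNReal.tendsto_toReal (measure_ne_top _ _)).comp h4
  refine tendsto_nhds_unique h5 ?_
  simp only [Function.comp_def, h2, h1]
  simp only [ENNReal.toReal_ofReal (iterate_run_nonneg (indicator_one_nonneg A) _ _)]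
  exact tendsto_reach hA _

theorem ae_mem_eventually_iff (M : MDP S Act) (𝔖 : M.Scheduler) (s : S) (T : Set S) :
    ∀ᵐ ω ∂(M.Pr 𝔖 s), ∀ n, ω n ∈ FinPath.visits Act T ↔ ∃ j ≤ n, (ω j).last ∈ T := by
  filter_upwards [M.ae_zero 𝔖 s, M.ae_succ 𝔖 s] with ω h0 hω n
  induction n with
  | zero => simp [h0, FinPath.visits, FinPath.start]
  | succ n ih =>
    have h1 : (∃ j ≤ n + 1, (ω j).last ∈ T) ↔ (ω (n + 1)).last ∈ T ∨ ∃ j ≤ n, (ω j).last ∈ T := by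
      constructor
      · rintro ⟨j, hj, h⟩
        rcases hj.eq_or_lt with rfl | hj
        · exact Or.inl h
        · exact Or.inr ⟨j, Nat.lt_succ_iff.1 hj, h⟩
      · rintro (h | ⟨j, hj, h⟩)
        · exact ⟨n + 1, le_rfl, h⟩
        · exact ⟨j, hj.trans n.le_succ, h⟩
    rw [h1, ← ih]
    rcases hω n with h | ⟨α, t, h⟩
    · rw [h]
      exact ⟨Or.inr, fun h' => h'.elim Or.inl id⟩
    · rw [h, FinPath.extend_mem_visits]
      rfl

theorem toReal_Pr_eventually (M : MDP S Act) (𝔖 : M.Scheduler) (s : S) (T : Set S) :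
    (M.Pr 𝔖 s (eventually Act T)).toReal
      = M.reach 𝔖 (FinPath.visits Act T) (FinPath.start s) := by
  rw [← toReal_Pr_exists_mem (FinPath.persistent_visits T)]
  congr 1
  refine measure_congr ?_
  filter_upwards [M.ae_mem_eventually_iff 𝔖 s T] with ω hω
  refine propext ⟨?_, ?_⟩
  · rintro ⟨j, -, hj⟩
    exact ⟨j, (hω j).2 ⟨j, le_rfl, hj⟩⟩
  · rintro ⟨j, hj⟩
    obtain ⟨i, -, hi⟩ := (hω j).1 hj
    exact ⟨i, fun _ _ => trivial, hi⟩

theorem toReal_Pr_eventually_inter (M : MDP S Act) (𝔖 : M.Scheduler) (s : S) (T U : Set S) :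
    (M.Pr 𝔖 s (eventually Act T ∩ eventually Act U)).toReal
      = M.reach 𝔖 (FinPath.visits Act T ∩ FinPath.visits Act U) (FinPath.start s) := by
  rw [← toReal_Pr_exists_mem ((FinPath.persistent_visits T).inter (FinPath.persistent_visits U))]
  congr 1
  refine measure_congr ?_
  filter_upwards [M.ae_mem_eventually_iff 𝔖 s T, M.ae_mem_eventually_iff 𝔖 s U] with ω hT hU
  refine propext ⟨?_, ?_⟩
  · rintro ⟨⟨j, -, hj⟩, ⟨i, -, hi⟩⟩
    exact ⟨max i j, (hT _).2 ⟨j, le_max_right _ _, hj⟩, (hU _).2 ⟨i, le_max_left _ _, hi⟩⟩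
  · rintro ⟨j, hjT, hjU⟩
    obtain ⟨i, -, hi⟩ := (hT j).1 hjT
    obtain ⟨k, -, hk⟩ := (hU j).1 hjU
    exact ⟨⟨i, fun _ _ => trivial, hi⟩, ⟨k, fun _ _ => trivial, hk⟩⟩

/-- The conditional probability is cleared of its denominator; everything becomes a statement on
real `reach` values. -/
theorem refutesGPR_iff (M : MDP S Act) (Eff Cause : Set S) (𝔖 : M.Scheduler) :
    M.RefutesGPR Eff Cause 𝔖 ↔
      0 < M.reach 𝔖 (FinPath.visits Act Cause) (FinPath.start M.init) ∧
      M.reach 𝔖 (FinPath.visits Act Cause ∩ FinPath.visits Act Eff) (FinPath.start M.init)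
        ≤ M.reach 𝔖 (FinPath.visits Act Cause) (FinPath.start M.init)
          * M.reach 𝔖 (FinPath.visits Act Eff) (FinPath.start M.init) := by
  rw [← toReal_Pr_eventually, ← toReal_Pr_eventually, ← toReal_Pr_eventually_inter]
  unfold RefutesGPR Raises
  rw [ProbabilityTheory.cond_apply (measurableSet_eventually Cause), not_lt]
  set μ := M.Pr 𝔖 M.init
  rw [ENNReal.toReal_pos_iff, and_iff_left (measure_lt_top _ _)]
  refine and_congr_right fun hpos => ?_
  rw [← ENNReal.toReal_mul, ENNReal.toReal_le_toReal (measure_ne_top _ _)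
    (ENNReal.mul_ne_top (measure_ne_top _ _) (measure_ne_top _ _)),
    ENNReal.inv_mul_le_iff hpos.ne' (measure_ne_top _ _)]

end reach

section residual

variable {M : MDP S Act} {𝔖 : M.Scheduler} {D : Set S}

theorem iterate_run_append (g : FinPath S Act → ℝ) (π : FinPath S Act) (n : ℕ) :
    ∀ π', (M.run 𝔖 D)^[n] g (π.append π')
      = (M.run (𝔖.after π) D)^[n] (fun π' => g (π.append π')) π' := by
  induction n with
  | zero => exact fun _ => rfl
  | succ n ih =>
    intro π'
    rw [Function.iterate_succ_apply', Function.iterate_succ_apply']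
    by_cases h : π'.last ∈ D ∨ M.IsTerminal π'.last
    · rw [run_of_stop (π := π.append π') h, run_of_stop h, ih]
    · rw [not_or] at h
      rw [run_of_not_stop (π := π.append π') h.1 h.2, run_of_not_stop h.1 h.2]
      simp only [FinPath.append_extend, ih]
      rfl

theorem reach_visits_eq_after {T : Set S} {π : FinPath S Act} (hπ : ∀ x ∈ π.hist, x.1 ∉ T) :
    M.reach 𝔖 (FinPath.visits Act T) π
      = M.reach (𝔖.after π) (FinPath.visits Act T) (FinPath.start π.last) := by
  unfold reach
  refine iSup_congr fun n => ?_
  have h := iterate_run_append (M := M) (𝔖 := 𝔖) (D := ∅)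
    ((FinPath.visits Act T).indicator 1) π n (FinPath.start π.last)
  have h1 : π.append (FinPath.start π.last) = π := by simp [FinPath.append, FinPath.start]
  rw [h1] at h
  rw [h]
  refine congrArg (fun g => (M.run (𝔖.after π) ∅)^[n] g _) (funext fun π' => ?_)
  have h2 : π.append π' ∈ FinPath.visits Act T ↔ π' ∈ FinPath.visits Act T := by
    simp only [FinPath.visits, FinPath.append, Set.mem_ofPred_eq, List.mem_append]
    refine or_congr Iff.rfl ⟨?_, ?_⟩
    · rintro ⟨x, h | h, hx⟩
      · exact absurd hx (hπ x h)
      · exact ⟨x, h, hx⟩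
    · rintro ⟨x, h, hx⟩
      exact ⟨x, Or.inr h, hx⟩
  by_cases h3 : π' ∈ FinPath.visits Act T
  · simp [h3, h2.2 h3]
  · rw [Set.indicator_of_notMem h3, Set.indicator_of_notMem fun h' => h3 (h2.1 h')]

/-- After a path that has not met `T` before its last state, the residual scheduler competes in the
infimum defining `minReach`. -/
theorem minReach_le (M : MDP S Act) (𝔖 : M.Scheduler) (T : Set S) {π : FinPath S Act}
    (hπ : ∀ x ∈ π.hist, x.1 ∉ T) :
    M.minReach T π.last ≤ M.reach 𝔖 (FinPath.visits Act T) π := by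
  rw [reach_visits_eq_after hπ, ← toReal_Pr_eventually]
  exact ENNReal.toReal_mono (measure_ne_top _ _) (iInf_le _ _)

theorem le_minReach (M : MDP S Act) (T : Set S) {s : S} {c : ℝ}
    (h : ∀ 𝔖, c ≤ M.reach 𝔖 (FinPath.visits Act T) (FinPath.start s)) : c ≤ M.minReach T s := by
  refine (ENNReal.ofReal_le_iff_le_toReal ?_).1 (le_iInf fun 𝔖 => ?_)
  · exact ((M.prMin_le_one s _).trans_lt ENNReal.one_lt_top).ne
  · rw [ENNReal.ofReal_le_iff_le_toReal (measure_ne_top _ _), toReal_Pr_eventually]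
    exact h 𝔖

theorem minReach_eq_one (M : MDP S Act) {T : Set S} {s : S} (hs : s ∈ T) : M.minReach T s = 1 := by
  refine le_antisymm (M.minReach_le_one T s) (M.le_minReach T fun 𝔖 => ?_)
  rw [reach_of_mem (FinPath.persistent_visits T) (Or.inl hs)]

/-- One half of the Bellman equation: under any scheduler the first step averages over actions, each
costing at least the best one-step value. -/
theorem exists_minimizing_action (M : MDP S Act) {T : Set S} {s : S} (hs : s ∉ T)
    (hterm : ¬ M.IsTerminal s) :
    ∃ α, M.Enabled s α ∧ ∑ t, M.P s α t * M.minReach T t ≤ M.minReach T s := by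
  classical
  obtain ⟨α₀, hα₀⟩ : ∃ α, M.Enabled s α := by simpa [IsTerminal] using hterm
  obtain ⟨α, hα, hmin⟩ := Finset.exists_min_image (Finset.univ.filter (M.Enabled s))
    (fun α => ∑ t, M.P s α t * M.minReach T t) ⟨α₀, by simpa using hα₀⟩
  refine ⟨α, by simpa using hα, M.le_minReach T fun 𝔖 => ?_⟩
  rw [reach_eq_sum (FinPath.persistent_visits T) hterm]
  calc ∑ t, M.P s α t * M.minReach T t
      = ∑ β, M.prob 𝔖 (FinPath.start s) β * ∑ t, M.P s α t * M.minReach T t := by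
        rw [← Finset.sum_mul, sum_prob (M := M) (π := FinPath.start s) hterm, one_mul]
    _ ≤ _ := by
        refine Finset.sum_le_sum fun β _ => ?_
        by_cases hβ : M.prob 𝔖 (FinPath.start s) β = 0
        · simp [hβ]
        · refine mul_le_mul_of_nonneg_left ?_ (M.prob_nonneg 𝔖 _ β)
          refine (hmin β (Finset.mem_filter.2 ⟨Finset.mem_univ _, enabled_of_prob_ne_zero hβ⟩)).trans ?_
          refine Finset.sum_le_sum fun t _ => mul_le_mul_of_nonneg_left ?_ (NNReal.coe_nonneg _)
          refine M.minReach_le 𝔖 T (π := (FinPath.start s).extend β t) fun x hx => ?_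
          have : x = (s, β) := by simpa [FinPath.start, FinPath.extend] using hx
          simpa [this] using hs

/-- There is a memoryless scheduler that minimizes the probability to reach `T` everywhere. -/
theorem exists_minimizing_scheduler (M : MDP S Act) (T : Set S) (hT : ∀ s ∈ T, M.IsTerminal s) :
    ∃ τ : (s : S) → ¬ M.IsTerminal s → PMF (M.EnabledAct s),
      ∀ (𝔖 : M.Scheduler) (A : Set (FinPath S Act)), FinPath.Persistent A →
        (∀ π ∈ A, ∀ h, 𝔖.choice π h = τ π.last h) →
        ∀ n, ∀ π ∈ A, (∀ x ∈ π.hist, x.1 ∉ T) →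
          (M.run 𝔖 ∅)^[n] ((FinPath.visits Act T).indicator 1) π ≤ M.minReach T π.last := by
  classical
  have hex : ∀ s, ∀ _ : ¬ M.IsTerminal s, ∃ p : PMF (M.EnabledAct s),
      ∑ α, M.actProb p α * ∑ t, M.P s α t * M.minReach T t ≤ M.minReach T s := by
    intro s hs
    obtain ⟨α, hα, hle⟩ := M.exists_minimizing_action (fun h => hs (hT s h)) hs
    obtain ⟨p, hp⟩ := M.exists_actProb_eq (s := s) (w := Pi.single α 1)
      (Pi.single_nonneg.2 zero_le_one) (by simp) (fun α' hne => by
        have : α' = α := by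
          by_contra h'
          exact hne (Pi.single_eq_of_ne h' _)
        exact this ▸ hα)
    refine ⟨p, ?_⟩
    rw [hp, Finset.sum_eq_single α]
    · simpa using hle
    · intro β _ hβ
      simp [Pi.single_eq_of_ne hβ]
    · simp
  choose τ hτ using hex
  refine ⟨τ, fun 𝔖 A hA hchoice n => ?_⟩
  have hkept : ∀ π : FinPath S Act, (∀ x ∈ π.hist, x.1 ∉ T) →
      (FinPath.visits Act T).indicator (1 : FinPath S Act → ℝ) π ≤ M.minReach T π.last := by
    intro π hπ
    by_cases h : π ∈ FinPath.visits Act T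
    · have h' : π.last ∈ T := h.resolve_right fun ⟨x, hx, hxT⟩ => hπ x hx hxT
      simp [h, M.minReach_eq_one h']
    · rw [Set.indicator_of_notMem h]
      exact M.minReach_nonneg T _
  -- `minReach` is superharmonic for the greedy choice `τ` and dominates the indicator of `T`, so it
  -- dominates every finite-horizon reachability probability.
  induction n with
  | zero => exact fun π _ hπ => hkept π hπ
  | succ n ih =>
    intro π hπA hπ
    by_cases h : M.IsTerminal π.last
    · rw [iterate_run_of_stop (Or.inr h)]
      exact hkept π hπ
    · rw [Function.iterate_succ_apply', run_of_not_stop (Set.notMem_empty _) h]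
      refine le_trans ?_ (hτ π.last h)
      refine Finset.sum_le_sum fun α _ => ?_
      have hp : M.prob 𝔖 π α = M.actProb (τ π.last h) α := by
        rw [prob, dif_neg h, hchoice π hπA h]
      rw [hp]
      refine mul_le_mul_of_nonneg_left (Finset.sum_le_sum fun t _ => ?_) (M.actProb_nonneg _ α)
      refine mul_le_mul_of_nonneg_left ?_ (NNReal.coe_nonneg _)
      refine ih _ (hA π hπA α t) fun x hx => ?_
      rcases List.mem_append.1 hx with hx | hx
      · exact hπ x hx
      · rw [List.mem_singleton.1 hx]
        exact fun hxT => h (hT _ hxT)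

end residual

end MDP

/-! ### Stopping at the first visit to `Cause ∪ Eff` -/

namespace FinPath

variable {S Act : Type*}

/-- The path does not visit `T` before its last state. -/
def Fresh (T : Set S) (π : FinPath S Act) : Prop := ∀ x ∈ π.hist, x.1 ∉ T

theorem fresh_start (T : Set S) (s : S) : Fresh T (start s : FinPath S Act) := by
  simp [Fresh, start]

theorem Fresh.extend {T : Set S} {π : FinPath S Act} (h : Fresh T π) (hl : π.last ∉ T) (α : Act)
    (t : S) : Fresh T (π.extend α t) := by
  intro x hx
  rcases List.mem_append.1 hx with hx | hx
  · exact h x hx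
  · rw [List.mem_singleton.1 hx]
    exact hl

theorem Fresh.mem_visits_iff {T U : Set S} {π : FinPath S Act} (h : Fresh T π) (hU : U ⊆ T) :
    π ∈ visits Act U ↔ π.last ∈ U :=
  ⟨fun h' => h'.resolve_right fun ⟨x, hx, hxU⟩ => h x hx (hU hxU), Or.inl⟩

end FinPath

namespace MDP

variable {S Act : Type*} [Fintype S] [Fintype Act] {M : MDP S Act} {𝔖 : M.Scheduler}

/-- Transfers estimates from the full process to the one stopped in `T`: whatever happens after the
first visit has to be bounded by the value `g` at that visit, uniformly in the remaining horizon. -/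
theorem iterate_run_le_of_fresh {T : Set S} {f g : FinPath S Act → ℝ}
    (hkept : ∀ π : FinPath S Act, π.Fresh T → π.last ∈ T ∨ M.IsTerminal π.last →
      ∀ n, (M.run 𝔖 ∅)^[n] f π ≤ g π)
    (h0 : ∀ π : FinPath S Act, π.Fresh T → π.last ∉ T → f π ≤ g π) (n : ℕ) :
    ∀ π : FinPath S Act, π.Fresh T → (M.run 𝔖 ∅)^[n] f π ≤ (M.run 𝔖 T)^[n] g π := by
  induction n with
  | zero =>
    intro π hπ
    by_cases h : π.last ∈ T
    · exact hkept π hπ (Or.inl h) 0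
    · exact h0 π hπ h
  | succ n ih =>
    intro π hπ
    by_cases h : π.last ∈ T ∨ M.IsTerminal π.last
    · rw [iterate_run_of_stop h]
      exact hkept π hπ h _
    · rw [not_or] at h
      rw [Function.iterate_succ_apply', Function.iterate_succ_apply', run_of_not_stop h.1 h.2,
        run_of_not_stop (Set.notMem_empty _) h.2]
      exact Finset.sum_le_sum fun α _ => mul_le_mul_of_nonneg_left (Finset.sum_le_sum fun t _ =>
        mul_le_mul_of_nonneg_left (ih _ (hπ.extend h.1 α t)) (NNReal.coe_nonneg _))
        (M.prob_nonneg 𝔖 π α)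

theorem iterate_run_eq_of_fresh {T : Set S} {f g : FinPath S Act → ℝ}
    (hkept : ∀ π : FinPath S Act, π.Fresh T → π.last ∈ T ∨ M.IsTerminal π.last →
      ∀ n, (M.run 𝔖 ∅)^[n] f π = g π)
    (h0 : ∀ π : FinPath S Act, π.Fresh T → π.last ∉ T → f π = g π) (n : ℕ)
    {π : FinPath S Act} (hπ : π.Fresh T) : (M.run 𝔖 ∅)^[n] f π = (M.run 𝔖 T)^[n] g π := by
  have hneg : ∀ (D : Set S) (n : ℕ) (f : FinPath S Act → ℝ),
      (M.run 𝔖 D)^[n] (-f) = -(M.run 𝔖 D)^[n] f := fun D n f => by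
    rw [iterate_run_eq, map_neg]
  refine le_antisymm (iterate_run_le_of_fresh (fun π h h' n => (hkept π h h' n).le)
    (fun π h h' => (h0 π h h').le) n π hπ) ?_
  have := iterate_run_le_of_fresh (M := M) (𝔖 := 𝔖) (T := T) (f := -f) (g := -g)
    (fun π h h' n => by rw [hneg]; exact neg_le_neg (hkept π h h' n).ge)
    (fun π h h' => neg_le_neg (h0 π h h').ge) n π hπ
  rw [hneg, hneg] at this
  exact neg_le_neg_iff.1 this

section decomposition

variable {E C : Set S}

theorem iterate_run_visits_cause (hE : ∀ s ∈ E, M.IsTerminal s) (n : ℕ)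
    {π : FinPath S Act} (hπ : π.Fresh (C ∪ E)) :
    (M.run 𝔖 ∅)^[n] ((FinPath.visits Act C).indicator 1) π
      = (M.run 𝔖 (C ∪ E))^[n] (fun π => C.indicator (1 : S → ℝ) π.last) π := by
  have hval : ∀ π : FinPath S Act, π.Fresh (C ∪ E) →
      (FinPath.visits Act C).indicator (1 : FinPath S Act → ℝ) π
        = C.indicator (1 : S → ℝ) π.last := fun π hπ => by
    by_cases h : π.last ∈ C
    · simp [h, (hπ.mem_visits_iff Set.subset_union_left).2 h]
    · rw [Set.indicator_of_notMem h, Set.indicator_of_notMem fun h' =>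
        h ((hπ.mem_visits_iff Set.subset_union_left).1 h')]
  refine iterate_run_eq_of_fresh (fun π hπ hs n => ?_) (fun π hπ _ => hval π hπ) n hπ
  rw [← hval π hπ]
  by_cases h : π ∈ FinPath.visits Act C
  · rw [iterate_run_indicator_of_mem (FinPath.persistent_visits C) h]
    simp [h]
  · have hterm : M.IsTerminal π.last :=
      hs.elim (fun h' => h'.elim (fun hC => absurd (Or.inl hC) h) (hE _)) id
    rw [iterate_run_of_stop (Or.inr hterm)]

/-- An effect is reached either after a cause or as the first visited state of `C ∪ E`; the latter
part is `u`. Since effects are terminal, no cause can follow them. -/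
theorem iterate_run_visits_effect (hE : ∀ s ∈ E, M.IsTerminal s) (hCE : Disjoint C E) (n : ℕ)
    {π : FinPath S Act} (hπ : π.Fresh (C ∪ E)) :
    (M.run 𝔖 ∅)^[n] ((FinPath.visits Act E).indicator 1) π
      = (M.run 𝔖 ∅)^[n] ((FinPath.visits Act C ∩ FinPath.visits Act E).indicator 1) π
        + (M.run 𝔖 (C ∪ E))^[n] (fun π => E.indicator (1 : S → ℝ) π.last) π := by
  set f : FinPath S Act → ℝ := (FinPath.visits Act E).indicator 1
    - (FinPath.visits Act C ∩ FinPath.visits Act E).indicator 1 with hf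
  have hval : ∀ π : FinPath S Act, π.Fresh (C ∪ E) → f π = E.indicator (1 : S → ℝ) π.last := by
    intro π hπ
    have h1 := hπ.mem_visits_iff (Set.subset_union_left (s := C) (t := E))
    have h2 := hπ.mem_visits_iff (Set.subset_union_right (s := C) (t := E))
    by_cases h : π.last ∈ E
    · have h3 : π.last ∉ C := fun h' => Set.disjoint_left.1 hCE h' h
      simp [hf, h1, h2, h, h3]
    · simp [hf, h2, h]
  rw [← iterate_run_eq_of_fresh (f := f) (fun π hπ hs n => ?_) (fun π hπ _ => hval π hπ) n hπ]
  · rw [hf, iterate_run_eq, map_sub, Pi.sub_apply]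
    ring
  · rw [← hval π hπ]
    by_cases hterm : M.IsTerminal π.last
    · rw [iterate_run_of_stop (Or.inr hterm)]
    · have hC : π.last ∈ C := (hs.resolve_right hterm).resolve_right fun h => hterm (hE _ h)
      have h0 : ∀ π ∈ FinPath.visits Act C, f π = (fun _ => (0 : ℝ)) π := fun π h => by
        by_cases h' : π ∈ FinPath.visits Act E <;> simp [hf, h, h']
      have hmem : π ∈ FinPath.visits Act C := Or.inl hC
      rw [iterate_run_congr_on (FinPath.persistent_visits C) h0 n hmem, iterate_run_const,
        h0 π hmem]

/-- The estimate `j ≤ w` for schedulers that behave well after reaching `C`;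
`iterate_run_le_reach_both` is the opposite estimate `w ≤ j`, valid for every scheduler. -/
theorem iterate_run_visits_both_le {m : S → ℝ} (hE : ∀ s ∈ E, M.IsTerminal s)
    (hmin : ∀ π : FinPath S Act, π.Fresh (C ∪ E) → π.last ∈ C → ∀ n,
      (M.run 𝔖 ∅)^[n] ((FinPath.visits Act E).indicator 1) π ≤ m π.last) (n : ℕ)
    {π : FinPath S Act} (hπ : π.Fresh (C ∪ E)) :
    (M.run 𝔖 ∅)^[n] ((FinPath.visits Act C ∩ FinPath.visits Act E).indicator 1) π
      ≤ (M.run 𝔖 (C ∪ E))^[n] (fun π => C.indicator m π.last) π := by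
  have h0 : ∀ π : FinPath S Act, π.Fresh (C ∪ E) → π.last ∉ C →
      (FinPath.visits Act C ∩ FinPath.visits Act E).indicator (1 : FinPath S Act → ℝ) π
        ≤ C.indicator m π.last := fun π hπ h => by
    rw [Set.indicator_of_notMem h, Set.indicator_of_notMem fun h' =>
      h ((hπ.mem_visits_iff Set.subset_union_left).1 h'.1)]
  refine iterate_run_le_of_fresh (fun π hπ hs n => ?_) (fun π hπ h =>
    h0 π hπ fun h' => h (Or.inl h')) n π hπ
  by_cases hC : π.last ∈ C
  · rw [Set.indicator_of_mem hC]
    refine le_trans (iterate_run_mono (fun π => ?_) n π) (hmin π hπ hC n)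
    exact Set.indicator_le_indicator_of_subset Set.inter_subset_right (fun _ => zero_le_one) π
  · have hterm : M.IsTerminal π.last := hs.elim (fun h => hE _ (h.resolve_left hC)) id
    rw [iterate_run_of_stop (Or.inr hterm)]
    exact h0 π hπ hC

theorem iterate_run_le_reach_both (n : ℕ) :
    ∀ π : FinPath S Act, π.Fresh (C ∪ E) →
    (M.run 𝔖 (C ∪ E))^[n] (fun π => C.indicator (M.minReach E) π.last) π
      ≤ M.reach 𝔖 (FinPath.visits Act C ∩ FinPath.visits Act E) π := by
  have hper := (FinPath.persistent_visits (Act := Act) C).inter (FinPath.persistent_visits E)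
  have h0 : ∀ π : FinPath S Act, π.Fresh (C ∪ E) → C.indicator (M.minReach E) π.last
      ≤ M.reach 𝔖 (FinPath.visits Act C ∩ FinPath.visits Act E) π := by
    intro π hπ
    by_cases h : π.last ∈ C
    · rw [Set.indicator_of_mem h]
      refine (M.minReach_le 𝔖 E fun x hx hxE => hπ x hx (Or.inr hxE)).trans (le_of_eq ?_)
      unfold reach
      refine iSup_congr fun n => ?_
      refine iterate_run_congr_on (FinPath.persistent_visits C) (fun π' h' => ?_) n (Or.inl h)
      by_cases h'' : π' ∈ FinPath.visits Act E <;> simp [h', h'']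
    · rw [Set.indicator_of_notMem h]
      exact reach_nonneg hper
  induction n with
  | zero => exact h0
  | succ n ih =>
    intro π hπ
    by_cases h : π.last ∈ C ∪ E ∨ M.IsTerminal π.last
    · rw [iterate_run_of_stop h]
      exact h0 π hπ
    · rw [not_or] at h
      rw [Function.iterate_succ_apply', run_of_not_stop h.1 h.2, reach_eq_sum hper h.2]
      exact Finset.sum_le_sum fun α _ => mul_le_mul_of_nonneg_left (Finset.sum_le_sum fun t _ =>
        mul_le_mul_of_nonneg_left (ih _ (hπ.extend h.1 α t)) (NNReal.coe_nonneg _))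
        (M.prob_nonneg 𝔖 π α)

end decomposition

/-! ### State distributions of the stopped process as flows -/

section occupation

variable {T : Set S}

open Classical in
/-- The probability to be in `s` after `n` steps from `s₀`, for the process stopped in `T`. -/
noncomputable def stateProb (M : MDP S Act) (𝔖 : M.Scheduler) (T : Set S) (s₀ : S) (n : ℕ)
    (s : S) : ℝ :=
  (M.run 𝔖 T)^[n] (fun π => (Pi.single s 1 : S → ℝ) π.last) (FinPath.start s₀)

open Classical in
theorem stateProb_zero (s₀ : S) : M.stateProb 𝔖 T s₀ 0 = Pi.single s₀ 1 := by
  ext s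
  simp only [stateProb, Function.iterate_zero, id, FinPath.start]
  exact Pi.single_comm s 1 s₀

open Classical in
theorem iterate_run_state (r : S → ℝ) (n : ℕ) (s₀ : S) :
    (M.run 𝔖 T)^[n] (fun π => r π.last) (FinPath.start s₀) = r ⬝ᵥ M.stateProb 𝔖 T s₀ n := by
  have h : (fun π : FinPath S Act => r π.last)
      = ∑ s, r s • fun π : FinPath S Act => (Pi.single s 1 : S → ℝ) π.last := by
    ext π
    simp [Finset.sum_apply, Pi.single_apply]
  rw [h, iterate_run_eq, map_sum, Finset.sum_apply]
  refine Finset.sum_congr rfl fun s _ => ?_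
  rw [map_smul, Pi.smul_apply, smul_eq_mul, stateProb, iterate_run_eq]

theorem stateProb_nonneg (s₀ : S) (n : ℕ) : 0 ≤ M.stateProb 𝔖 T s₀ n := by
  classical
  intro s
  exact iterate_run_nonneg (fun π =>
    (Pi.single_nonneg.2 zero_le_one : (0 : S → ℝ) ≤ Pi.single s 1) π.last) n _

theorem sum_stateProb (s₀ : S) (n : ℕ) : ∑ s, M.stateProb 𝔖 T s₀ n s = 1 := by
  have h := iterate_run_state (M := M) (𝔖 := 𝔖) (T := T) 1 n s₀
  rw [one_dotProduct] at h
  rw [← h]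
  exact congrFun (iterate_run_const 1 n) _

-- The flow collects, over the steps before `n`, the probability of being in a state outside `T` and
-- choosing a given action there.
open Classical in
theorem exists_flow_stateProb (s₀ : S) (n : ℕ) :
    ∃ y, M.IsFlow T y ∧ M.stateProb 𝔖 T s₀ n = Pi.single s₀ 1 + M.netFlow y := by
  induction n with
  | zero => exact ⟨0, M.isFlow_zero T, by rw [stateProb_zero, map_zero, add_zero]⟩
  | succ n ih =>
    obtain ⟨y, hy, heq⟩ := ih
    set φ : S × Act → FinPath S Act → ℝ := fun i π =>
      if π.last = i.1 ∧ i.1 ∉ T then M.prob 𝔖 π i.2 else 0 with hφ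
    have hφ0 : ∀ i, 0 ≤ φ i := fun i π => by
      simp only [hφ]
      split_ifs
      · exact M.prob_nonneg 𝔖 π i.2
      · exact le_rfl
    refine ⟨y + fun i => (M.run 𝔖 T)^[n] (φ i) (FinPath.start s₀),
      hy.add ⟨fun i => iterate_run_nonneg (hφ0 i) n _, fun i hi => ?_⟩, ?_⟩
    · by_contra hcon
      refine hi ?_
      have : φ i = fun _ => 0 := by
        ext π
        simp only [hφ]
        split_ifs with h
        · by_contra hne
          exact hcon ⟨h.2, h.1 ▸ enabled_of_prob_ne_zero hne⟩
        · rfl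
      rw [this, iterate_run_const]
    · ext t
      have hpt : M.run 𝔖 T (fun π => (Pi.single t 1 : S → ℝ) π.last)
          = (fun π => (Pi.single t 1 : S → ℝ) π.last)
            + ∑ i : S × Act, ((M.P i.1 i.2 t : ℝ) - (Pi.single i.1 1 : S → ℝ) t) • φ i := by
        ext π
        rw [Pi.add_apply, Finset.sum_apply, Fintype.sum_prod_type, Finset.sum_eq_single π.last]
        · by_cases h : π.last ∈ T ∨ M.IsTerminal π.last
          · rw [run_of_stop h, Finset.sum_eq_zero, add_zero]
            intro α _
            rcases h with h | h
            · simp [hφ, h]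
            · simp [hφ, prob, h]
          · rw [not_or] at h
            rw [run_of_not_stop h.1 h.2]
            have h1 : ∀ α, ((M.P π.last α t : ℝ) - (Pi.single π.last 1 : S → ℝ) t)
                * φ (π.last, α) π = M.prob 𝔖 π α * M.P π.last α t
                  - M.prob 𝔖 π α * (Pi.single π.last 1 : S → ℝ) t := fun α => by
              simp only [hφ, h.1, not_false_iff, and_self, if_true]
              ring
            simp only [Pi.smul_apply, smul_eq_mul, h1, Finset.sum_sub_distrib]
            rw [← Finset.sum_mul, sum_prob h.2, one_mul, Pi.single_comm, add_sub_cancel]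
            refine Finset.sum_congr rfl fun α _ => ?_
            simp [FinPath.extend, Pi.single_apply]
        · intro s _ hs
          refine Finset.sum_eq_zero fun α _ => ?_
          simp [hφ, hs.symm]
        · simp
      have hn := congrFun heq t
      rw [map_add, Pi.add_apply, Pi.add_apply, ← add_assoc, ← Pi.add_apply, ← heq, stateProb,
        Function.iterate_succ_apply, hpt, iterate_run_eq, map_add, map_sum, Pi.add_apply,
        Finset.sum_apply, netFlow_apply, stateProb, iterate_run_eq]
      refine congrArg _ (Finset.sum_congr rfl fun i _ => ?_)
      rw [map_smul, Pi.smul_apply, smul_eq_mul, mul_comm]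

/-- Both `n` and `ε` are uniform in the scheduler's behaviour and in the history: a finite minimum
over the enabled actions handles any randomization. -/
theorem Forced.exists_le_iterate_run {s : S} (h : M.Forced T s) :
    ∃ (n : ℕ) (ε : ℝ), 0 < ε ∧ ∀ π : FinPath S Act, π.last = s →
      ε ≤ (M.run 𝔖 T)^[n] (fun π => T.indicator (1 : S → ℝ) π.last) π := by
  classical
  have hbase : ∀ s ∈ T, ∃ (n : ℕ) (ε : ℝ), 0 < ε ∧ ∀ π : FinPath S Act, π.last = s →
      ε ≤ (M.run 𝔖 T)^[n] (fun π => T.indicator (1 : S → ℝ) π.last) π := fun s hs =>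
    ⟨0, 1, one_pos, fun π hπ => by simp [hπ, hs]⟩
  have hmono : (fun π : FinPath S Act => T.indicator (1 : S → ℝ) π.last)
      ≤ M.run 𝔖 T (fun π => T.indicator (1 : S → ℝ) π.last) := by
    intro π
    by_cases hπ : π.last ∈ T
    · rw [run_of_stop (Or.inl hπ)]
    · dsimp only
      rw [Set.indicator_of_notMem hπ]
      exact iterate_run_nonneg (fun π => Set.indicator_nonneg (fun _ _ => zero_le_one) _) 1 π
  induction h with
  | base s hs => exact hbase s hs
  | step s hs f hf _ ih =>
    by_cases hsT : s ∈ T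
    · exact hbase s hsT
    choose n ε hε hle using ih
    obtain ⟨α₀, hα₀⟩ : ∃ α, M.Enabled s α := by simpa [IsTerminal] using hs
    have : Nonempty (M.EnabledAct s) := ⟨⟨α₀, hα₀⟩⟩
    obtain ⟨β, hβ⟩ := Finite.exists_min fun α : M.EnabledAct s => (M.P s α.1 (f α) : ℝ) * ε α
    have hpos : ∀ α : M.EnabledAct s, 0 < (M.P s α.1 (f α) : ℝ) := fun α =>
      NNReal.coe_pos.2 (pos_iff_ne_zero.2 (hf α))
    obtain ⟨N, hN⟩ := (Set.finite_range n).bddAbove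
    refine ⟨N + 1, M.P s β.1 (f β) * ε β, mul_pos (hpos β) (hε β), fun π hπ => ?_⟩
    subst hπ
    rw [Function.iterate_succ_apply', run_of_not_stop hsT hs]
    calc (M.P π.last β.1 (f β) : ℝ) * ε β
        = ∑ α, M.prob 𝔖 π α * (M.P π.last β.1 (f β) * ε β) := by
          rw [← Finset.sum_mul, sum_prob hs, one_mul]
      _ ≤ _ := by
          refine Finset.sum_le_sum fun α _ => ?_
          by_cases hα : M.prob 𝔖 π α = 0
          · simp [hα]
          · refine mul_le_mul_of_nonneg_left ?_ (M.prob_nonneg 𝔖 π α)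
            set α' : M.EnabledAct π.last := ⟨α, enabled_of_prob_ne_zero hα⟩
            refine (hβ α').trans ?_
            refine le_trans ?_ (Finset.single_le_sum (f := fun t => (M.P π.last α t : ℝ) *
              (M.run 𝔖 T)^[N] (fun π => T.indicator (1 : S → ℝ) π.last) (π.extend α t))
              (fun t _ => mul_nonneg (NNReal.coe_nonneg _) (iterate_run_nonneg (fun π =>
                Set.indicator_nonneg (fun _ _ => zero_le_one) _) N _)) (Finset.mem_univ (f α')))
            refine mul_le_mul_of_nonneg_left ?_ (NNReal.coe_nonneg _)
            refine (hle α' (π.extend α (f α')) rfl).trans ?_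
            exact monotone_iterate_run hmono _ (hN ⟨α', rfl⟩)

/-- Mass in `s` at time `k` makes the probability of being in `T` grow by at least `ε` times that
mass during the next `n` steps; this probability converges, so its increments vanish. -/
theorem Forced.tendsto_stateProb {s : S} (h : M.Forced T s) (hs : s ∉ T) (s₀ : S) :
    Filter.Tendsto (fun n => M.stateProb 𝔖 T s₀ n s) Filter.atTop (nhds 0) := by
  classical
  obtain ⟨n, ε, hε, hle⟩ := h.exists_le_iterate_run (𝔖 := 𝔖)
  set g : FinPath S Act → ℝ := fun π => T.indicator (1 : S → ℝ) π.last with hg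
  have hmono : g ≤ M.run 𝔖 T g := by
    intro π
    by_cases hπ : π.last ∈ T
    · rw [run_of_stop (Or.inl hπ)]
    · simp only [hg, Set.indicator_of_notMem hπ]
      exact iterate_run_nonneg (fun π => Set.indicator_nonneg (fun _ _ => zero_le_one) _) 1 π
  have hlim := tendsto_iterate_run hmono (c := 1)
    (fun π => Set.indicator_le_self' (fun _ _ => zero_le_one) _) (FinPath.start s₀)
  have hdiff := (((Filter.tendsto_add_atTop_iff_nat n).2 hlim).sub hlim).div_const ε
  rw [sub_self, zero_div] at hdiff
  refine tendsto_of_tendsto_of_tendsto_of_le_of_le tendsto_const_nhds hdiff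
    (fun k => stateProb_nonneg s₀ k s) fun k => ?_
  rw [le_div_iff₀ hε, le_sub_iff_add_le', Function.iterate_add_apply, mul_comm]
  have h1 : g + ε • (fun π : FinPath S Act => (Pi.single s 1 : S → ℝ) π.last)
      ≤ (M.run 𝔖 T)^[n] g := by
    intro π
    rw [Pi.add_apply, Pi.smul_apply, smul_eq_mul]
    by_cases hπ : π.last = s
    · rw [hπ, Pi.single_eq_same, mul_one]
      have : g π = 0 := by simp only [hg, hπ, Set.indicator_of_notMem hs]
      rw [this, zero_add]
      exact hle π hπ
    · rw [Pi.single_eq_of_ne hπ, mul_zero, add_zero]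
      exact monotone_iterate_run hmono π (Nat.zero_le n)
  have h2 := iterate_run_mono (M := M) (𝔖 := 𝔖) (D := T) h1 k (FinPath.start s₀)
  rwa [iterate_run_eq, map_add, map_smul, Pi.add_apply, Pi.smul_apply, smul_eq_mul,
    ← iterate_run_eq] at h2

end occupation

/-! ### From a refuting scheduler to a refuting balance -/

-- A subsequence of the stopped state distributions converges; its limit inherits `p` and `u`, and
-- satisfies `w ≤ j`.
open Classical in
theorem exists_balance_of_refutesGPR {E C : Set S} (hE : ∀ s ∈ E, M.IsTerminal s)
    (hCE : Disjoint C E) (h : M.RefutesGPR E C 𝔖) :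
    ∃ y β, M.IsBalance (C ∪ E) ∅ M.init y β ∧
      Refuting (C.indicator 1) (E.indicator 1) (C.indicator (M.minReach E)) β := by
  obtain ⟨hp, hj⟩ := (M.refutesGPR_iff E C 𝔖).1 h
  set a := M.stateProb 𝔖 (C ∪ E) M.init with ha
  have hfresh := FinPath.fresh_start (Act := Act) (C ∪ E) M.init
  have hper := (FinPath.persistent_visits (Act := Act) C).inter (FinPath.persistent_visits E)
  have hplim := tendsto_reach (M := M) (𝔖 := 𝔖) (FinPath.persistent_visits C)
    (FinPath.start M.init)
  have helim := tendsto_reach (M := M) (𝔖 := 𝔖) (FinPath.persistent_visits E)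
    (FinPath.start M.init)
  have hjlim := tendsto_reach (M := M) (𝔖 := 𝔖) hper (FinPath.start M.init)
  have hulim := helim.sub hjlim
  simp only [iterate_run_visits_cause hE _ hfresh, iterate_run_state] at hplim
  simp only [iterate_run_visits_effect hE hCE _ hfresh, add_sub_cancel_left,
    iterate_run_state] at hulim
  have hw : ∀ n, C.indicator (M.minReach E) ⬝ᵥ a n
      ≤ M.reach 𝔖 (FinPath.visits Act C ∩ FinPath.visits Act E) (FinPath.start M.init) :=
    fun n => by
      rw [ha, ← iterate_run_state]
      exact iterate_run_le_reach_both n _ hfresh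
  obtain ⟨β, hβ, φ, hφ, hlim⟩ := (isCompact_stdSimplex ℝ S).tendsto_subseq
    (x := a) fun n => ⟨stateProb_nonneg M.init n, sum_stateProb M.init n⟩
  have hcont : ∀ r : S → ℝ, Filter.Tendsto (fun n => r ⬝ᵥ a (φ n)) Filter.atTop
      (nhds (r ⬝ᵥ β)) := fun r => by
    have : Continuous fun β : S → ℝ => r ⬝ᵥ β := by
      unfold dotProduct
      fun_prop
    exact (this.tendsto β).comp hlim
  have hpβ := tendsto_nhds_unique (hcont _) (hplim.comp hφ.tendsto_atTop)
  have huβ := tendsto_nhds_unique (hcont _) (hulim.comp hφ.tendsto_atTop)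
  have hwβ := le_of_tendsto' (hcont _) fun n => hw (φ n)
  have hclosed : β - Pi.single M.init 1 ∈ {b | ∃ y, M.IsFlow (C ∪ E) y ∧ b = M.netFlow y} := by
    refine (M.isClosed_netFlow (C ∪ E)).mem_of_tendsto (hlim.sub_const (Pi.single M.init 1))
      (Filter.Eventually.of_forall fun n => ?_)
    obtain ⟨y, hy, heq⟩ := exists_flow_stateProb (M := M) (𝔖 := 𝔖) (T := C ∪ E) M.init (φ n)
    exact ⟨y, hy, by rw [Function.comp_apply, ha, heq, add_sub_cancel_left]⟩
  obtain ⟨y, hy, heq⟩ := hclosed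
  refine ⟨y, β, ⟨by rwa [Set.union_empty], by rw [← heq, add_sub_cancel], hβ.1, ?_⟩, ?_, ?_⟩
  · intro s hs hsT
    refine tendsto_nhds_unique (((continuous_apply s).tendsto β).comp hlim) ?_
    exact (hs.tendsto_stateProb hsT M.init).comp hφ.tendsto_atTop
  · rwa [hpβ]
  · have hp1 : M.reach 𝔖 (FinPath.visits Act C) (FinPath.start M.init) ≤ 1 :=
      ciSup_le fun n => iterate_run_le_of_le 1 (indicator_one_le_one _) n _
    rw [hpβ, huβ]
    -- From `w ≤ j`, `j ≤ p * (u + j)` and `p ≤ 1`: `(1 - p) * w ≤ (1 - p) * j ≤ p * u`.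
    nlinarith

end MDP

/-! ### From a memoryless choice before `Cause ∪ Eff` back to refuting schedulers -/

theorem tendsto_dotProduct_of_support {S : Type*} [Fintype S] {T : Set S} {r β : S → ℝ}
    {a : ℕ → S → ℝ} (hr : ∀ s ∉ T, r s = 0)
    (ha : ∀ s ∈ T, Filter.Tendsto (fun n => a n s) Filter.atTop (nhds (β s))) :
    Filter.Tendsto (fun n => r ⬝ᵥ a n) Filter.atTop (nhds (r ⬝ᵥ β)) := by
  refine tendsto_finsetSum _ fun s _ => ?_
  by_cases hs : s ∈ T
  · exact (ha s hs).const_mul _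
  · simp only [hr s hs, zero_mul]
    exact tendsto_const_nhds

open Classical in
theorem foldl_visits {S Act : Type*} (C : Set S) (l : List (S × Act)) (q : Fin 2) :
    l.foldl (fun q x => if x.1 ∈ C then 1 else q) q = if ∃ x ∈ l, x.1 ∈ C then 1 else q := by
  induction l generalizing q with
  | nil => simp
  | cons x l ih =>
    rw [List.foldl_cons, ih]
    by_cases h1 : x.1 ∈ C <;> by_cases h2 : ∃ y ∈ l, y.1 ∈ C <;> simp [h1, h2]

namespace MDP

variable {S Act : Type*} [Fintype S] {M : MDP S Act}

section minEffect

variable {E C : Set S} {eff : S} {noeff : Option S}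

theorem minEffect_P_some {s t : S} {α : Act} (hs : s ∉ C) :
    (M.minEffect E C eff noeff).P (some s) (some α) (some t) = M.P s α t := by
  simp [minEffect, minEffectP, hs]

theorem minEffect_enabled_some {s : S} {α : Act} :
    (M.minEffect E C eff noeff).Enabled (some s) (some α) ↔ s ∉ C ∧ M.Enabled s α := by
  by_cases hs : s ∈ C <;> simp [Enabled, minEffect, minEffectP, Fintype.sum_option, hs]

theorem minEffect_enabled_none {s : S} :
    (M.minEffect E C eff noeff).Enabled (some s) none ↔ s ∈ C := by
  classical
  by_cases hs : s ∈ C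
  · have hle : (M.prMin s (eventually Act E)).toNNReal ≤ 1 := by
      simpa using ENNReal.toNNReal_mono ENNReal.one_ne_top (M.prMin_le_one s (eventually Act E))
    simp only [Enabled, minEffect, minEffectP, hs, if_true, iff_true, Finset.sum_add_distrib,
      Finset.sum_ite_eq', Finset.mem_univ]
    exact add_tsub_cancel_of_le hle
  · simp [Enabled, minEffect, minEffectP, hs]

theorem minEffect_isTerminal_none : (M.minEffect E C eff noeff).IsTerminal none := by
  intro α
  simp [Enabled, minEffect, minEffectP]

theorem minEffect_isTerminal_some {s : S} :
    (M.minEffect E C eff noeff).IsTerminal (some s) ↔ s ∉ C ∧ M.IsTerminal s := by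
  constructor
  · intro h
    have hs : s ∉ C := fun hs => h none (minEffect_enabled_none.2 hs)
    exact ⟨hs, fun α hα => h (some α) (minEffect_enabled_some.2 ⟨hs, hα⟩)⟩
  · rintro ⟨hs, h⟩ (_ | α) hα
    · exact hs (minEffect_enabled_none.1 hα)
    · exact h α (minEffect_enabled_some.1 hα).2

end minEffect

variable [Fintype Act] {𝔖 : M.Scheduler}

/-- Common criterion for both MDPs: only an upper bound `m` on the effect probability after `C` is
needed, because a smaller `j` only helps to refute. -/
theorem refutesGPR_of_tendsto {E C : Set S} (hE : ∀ s ∈ E, M.IsTerminal s) (hCE : Disjoint C E)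
    {m : S → ℝ} {p u w : ℝ}
    (hmin : ∀ π : FinPath S Act, π.Fresh (C ∪ E) → π.last ∈ C → ∀ n,
      (M.run 𝔖 ∅)^[n] ((FinPath.visits Act E).indicator 1) π ≤ m π.last)
    (hp : Filter.Tendsto (fun n => C.indicator 1 ⬝ᵥ M.stateProb 𝔖 (C ∪ E) M.init n)
      Filter.atTop (nhds p))
    (hu : Filter.Tendsto (fun n => E.indicator 1 ⬝ᵥ M.stateProb 𝔖 (C ∪ E) M.init n)
      Filter.atTop (nhds u))
    (hw : Filter.Tendsto (fun n => C.indicator m ⬝ᵥ M.stateProb 𝔖 (C ∪ E) M.init n)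
      Filter.atTop (nhds w))
    (hpos : 0 < p) (hle : w ≤ p * (u + w)) : M.RefutesGPR E C 𝔖 := by
  rw [refutesGPR_iff]
  have hfresh := FinPath.fresh_start (Act := Act) (C ∪ E) M.init
  have hper := (FinPath.persistent_visits (Act := Act) C).inter (FinPath.persistent_visits E)
  have hplim := tendsto_reach (M := M) (𝔖 := 𝔖) (FinPath.persistent_visits C)
    (FinPath.start M.init)
  have helim := tendsto_reach (M := M) (𝔖 := 𝔖) (FinPath.persistent_visits E)
    (FinPath.start M.init)
  have hjlim := tendsto_reach (M := M) (𝔖 := 𝔖) hper (FinPath.start M.init)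
  have hp1 : M.reach 𝔖 (FinPath.visits Act C) (FinPath.start M.init) ≤ 1 :=
    ciSup_le fun n => iterate_run_le_of_le 1 (indicator_one_le_one _) n _
  have hjw := le_of_tendsto_of_tendsto' hjlim hw fun n => by
    rw [← iterate_run_state]
    exact iterate_run_visits_both_le hE hmin n hfresh
  simp only [iterate_run_visits_cause hE _ hfresh, iterate_run_state] at hplim
  simp only [iterate_run_visits_effect hE hCE _ hfresh, iterate_run_state] at helim
  have hpeq := tendsto_nhds_unique hplim hp
  have heeq := tendsto_nhds_unique helim (hjlim.add hu)
  rw [hpeq] at hp1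
  rw [hpeq, heeq]
  exact ⟨hpos, by nlinarith⟩

theorem iterate_run_congr_fresh {T : Set S} {f g : FinPath S Act → ℝ}
    (h : ∀ π : FinPath S Act, π.Fresh T → f π = g π) (n : ℕ) :
    ∀ π : FinPath S Act, π.Fresh T → (M.run 𝔖 T)^[n] f π = (M.run 𝔖 T)^[n] g π := by
  induction n with
  | zero => exact h
  | succ n ih =>
    intro π hπ
    rw [Function.iterate_succ_apply', Function.iterate_succ_apply']
    by_cases hs : π.last ∈ T ∨ M.IsTerminal π.last
    · rw [run_of_stop hs, run_of_stop hs, ih π hπ]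
    · rw [not_or] at hs
      rw [run_of_not_stop hs.1 hs.2, run_of_not_stop hs.1 hs.2]
      exact Finset.sum_congr rfl fun α _ => congrArg _ (Finset.sum_congr rfl fun t _ =>
        congrArg _ (ih _ (hπ.extend hs.1 α t)))

/-- The scheduler has to agree with `σ` only before `T` is reached, so this also covers the
scheduler that changes its behaviour after a cause. -/
theorem stateProb_succ {T : Set S} {σ : (s : S) → ¬ M.IsTerminal s → PMF (M.EnabledAct s)}
    (h : ∀ π : FinPath S Act, π.Fresh T → π.last ∉ T → ∀ hs, 𝔖.choice π hs = σ π.last hs)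
    (s₀ : S) (n : ℕ) (s : S) :
    M.stateProb 𝔖 T s₀ (n + 1) s
      = ∑ t, M.stateProb 𝔖 T s₀ n t * M.stopMatrix T σ t s := by
  classical
  have hstep : ∀ π : FinPath S Act, π.Fresh T →
      M.run 𝔖 T (fun π => (Pi.single s 1 : S → ℝ) π.last) π = M.stopMatrix T σ π.last s := by
    intro π hπ
    unfold stopMatrix
    split_ifs with h1 h2
    · rw [run_of_stop (Or.inl h1), Pi.single_comm]
    · rw [run_of_stop (Or.inr h2), Pi.single_comm]
    · rw [run_of_not_stop h1 h2]
      refine Finset.sum_congr rfl fun α _ => ?_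
      rw [prob, dif_neg h2, h π hπ h1 h2]
      simp [FinPath.extend, Pi.single_apply]
  have h1 := iterate_run_congr_fresh (M := M) (𝔖 := 𝔖) hstep n _ (FinPath.fresh_start T s₀)
  rw [stateProb, Function.iterate_succ_apply]
  convert h1.trans (iterate_run_state (fun t => M.stopMatrix T σ t s) n s₀) using 1
  exact Finset.sum_congr rfl fun t _ => mul_comm _ _

theorem exists_two_memory_refutesGPR (M : MDP S Act) {E C : Set S}
    (hE : ∀ s ∈ E, M.IsTerminal s) (hCE : Disjoint C E) {β : S → ℝ}
    (hβ : Refuting (C.indicator 1) (E.indicator 1) (C.indicator (M.minReach E)) β)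
    {σ : (s : S) → ¬ M.IsTerminal s → PMF (M.EnabledAct s)}
    (hσ : ∀ a : ℕ → S → ℝ, (∀ s, a 0 s = open Classical in (Pi.single M.init 1 : S → ℝ) s) →
      (∀ n s, a (n + 1) s = ∑ t, a n t * M.stopMatrix (C ∪ E) σ t s) →
      ∀ c ∈ C ∪ E, Filter.Tendsto (fun n => a n c) Filter.atTop (nhds (β c))) :
    ∃ 𝔗 : M.Scheduler, 𝔗.HasMemory 2 ∧ M.RefutesGPR E C 𝔗 := by
  classical
  obtain ⟨τ, hτ⟩ := M.exists_minimizing_scheduler E hE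
  set upd : Fin 2 → S → Fin 2 := fun q s => if s ∈ C then 1 else q
  -- The automaton reads only the states before the last one, so a cause in the last position is
  -- tested separately.
  set ρ : Fin 2 → (s : S) → ¬ M.IsTerminal s → PMF (M.EnabledAct s) :=
    fun q s h => if q = 1 ∨ s ∈ C then τ s h else σ s h with hρ
  set 𝔗 : M.Scheduler :=
    ⟨fun π h => ρ (π.hist.foldl (fun q x => upd q x.1) 0) π.last h⟩ with h𝔗
  have hfold : ∀ π : FinPath S Act, π.hist.foldl (fun q x => upd q x.1) 0
      = if ∃ x ∈ π.hist, x.1 ∈ C then 1 else 0 := fun π => foldl_visits C π.hist 0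
  have hvis : ∀ π ∈ FinPath.visits Act C, ∀ h, 𝔗.choice π h = τ π.last h := by
    intro π hπ h
    simp only [h𝔗, hρ, hfold]
    refine if_pos ?_
    rcases hπ with hπ | hπ
    · exact Or.inr hπ
    · exact Or.inl (if_pos hπ)
  have hfresh : ∀ π : FinPath S Act, π.Fresh (C ∪ E) → π.last ∉ C ∪ E →
      ∀ h, 𝔗.choice π h = σ π.last h := by
    intro π hπ hl h
    simp only [h𝔗, hρ, hfold]
    refine if_neg ?_
    rintro (h' | h')
    · rw [if_neg] at h'
      · exact absurd h' (by decide)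
      · rintro ⟨x, hx, hxC⟩
        exact hπ x hx (Or.inl hxC)
    · exact hl (Or.inl h')
  have hlim := hσ (M.stateProb 𝔗 (C ∪ E) M.init) (fun s => by rw [stateProb_zero])
    (stateProb_succ hfresh M.init)
  have hsupp : ∀ (U : Set S) (r : S → ℝ), U ⊆ C ∪ E → ∀ s ∉ C ∪ E, U.indicator r s = 0 :=
    fun U r hU s hs => Set.indicator_of_notMem (fun h => hs (hU h)) r
  refine ⟨𝔗, ⟨0, upd, ρ, fun π h => rfl⟩, refutesGPR_of_tendsto hE hCE (m := M.minReach E)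
    (fun π hπ hl n => hτ 𝔗 _ (FinPath.persistent_visits C) hvis n π (Or.inl hl)
      fun x hx hxE => hπ x hx (Or.inr hxE))
    (tendsto_dotProduct_of_support (hsupp C _ Set.subset_union_left) hlim)
    (tendsto_dotProduct_of_support (hsupp E _ Set.subset_union_right) hlim)
    (tendsto_dotProduct_of_support (hsupp C _ Set.subset_union_left) hlim) hβ.1 hβ.2⟩

/-! ### Transfer to the MDP with minimal effect probabilities -/

section minEffect

variable {E C : Set S} {eff : S} {noeff : Option S}

/-- From `c` only `γ` is enabled; its branch to `noeff` is lost for good, and its branch to `eff`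
has weight exactly `minReach`. -/
theorem minEffect_run_le (hCE : Disjoint C E)
    (hnoeff : ∀ t, noeff = some t → M.IsTerminal t ∧ t ∉ E ∧ t ∉ C)
    (𝔖 : (M.minEffect E C eff noeff).Scheduler) {π : FinPath (Option S) (Option Act)}
    (hπ : π.Fresh (some '' C ∪ some '' E)) {c : S} (hc : c ∈ C) (hlast : π.last = some c) (n : ℕ) :
    ((M.minEffect E C eff noeff).run 𝔖 ∅)^[n]
      ((FinPath.visits (Option Act) (some '' E)).indicator 1) π ≤ M.minReach E c := by
  classical
  have hcE : π.last ∉ some '' E := by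
    rw [hlast]
    rintro ⟨e, he, hec⟩
    exact Set.disjoint_left.1 hCE hc (Option.some_injective _ hec ▸ he)
  have hnv : π ∉ FinPath.visits (Option Act) (some '' E) := fun h =>
    hcE ((hπ.mem_visits_iff Set.subset_union_right).1 h)
  cases n with
  | zero =>
    rw [Function.iterate_zero, id, Set.indicator_of_notMem hnv]
    exact M.minReach_nonneg E c
  | succ n =>
    have hterm : ¬ (M.minEffect E C eff noeff).IsTerminal π.last := by
      rw [hlast, minEffect_isTerminal_some]
      exact fun h => h.1 hc
    rw [Function.iterate_succ_apply', run_of_not_stop (Set.notMem_empty _) hterm]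
    have hα : ∀ α, (M.minEffect E C eff noeff).prob 𝔖 π α *
        ∑ t, (M.minEffect E C eff noeff).P π.last α t * ((M.minEffect E C eff noeff).run 𝔖 ∅)^[n]
        ((FinPath.visits (Option Act) (some '' E)).indicator 1) (π.extend α t)
        ≤ (M.minEffect E C eff noeff).prob 𝔖 π α * M.minReach E c := by
      intro α
      by_cases hprob : (M.minEffect E C eff noeff).prob 𝔖 π α = 0
      · simp [hprob]
      refine mul_le_mul_of_nonneg_left ?_ ((M.minEffect E C eff noeff).prob_nonneg 𝔖 π α)
      have hen := enabled_of_prob_ne_zero hprob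
      rw [hlast] at hen
      rcases α with _ | α
      · calc _ ≤ ∑ t, if t = some eff then M.minReach E c else 0 := by
              refine Finset.sum_le_sum fun t _ => ?_
              have hP : ((M.minEffect E C eff noeff).P π.last none t : ℝ)
                  = (if t = some eff then M.minReach E c else 0)
                  + ((if t = noeff then 1 - (M.prMin c (eventually Act E)).toNNReal else 0 : ℝ≥0)
                    : ℝ) := by
                rw [hlast]
                simp only [minEffect, minEffectP, hc, if_true, NNReal.coe_add]
                congr 1
                split_ifs <;> rfl
              rw [hP]
              by_cases ht : t = noeff
              · have hzero : ((M.minEffect E C eff noeff).run 𝔖 ∅)^[n]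
                    ((FinPath.visits (Option Act) (some '' E)).indicator 1)
                    (π.extend none t) = 0 := by
                  have htt : (M.minEffect E C eff noeff).IsTerminal (π.extend none t).last := by
                    change (M.minEffect E C eff noeff).IsTerminal t
                    rcases t with _ | t
                    · exact minEffect_isTerminal_none
                    · exact minEffect_isTerminal_some.2
                        ⟨(hnoeff t ht.symm).2.2, (hnoeff t ht.symm).1⟩
                  rw [iterate_run_of_stop (Or.inr htt), Set.indicator_of_notMem]
                  rw [FinPath.extend_mem_visits]
                  rintro (⟨e, he, rfl⟩ | h)
                  · exact (hnoeff e ht.symm).2.1 he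
                  · exact hnv h
                rw [hzero, mul_zero]
                split_ifs
                · exact M.minReach_nonneg E c
                · exact le_rfl
              · rw [if_neg ht, NNReal.coe_zero, add_zero]
                refine mul_le_of_le_one_right ?_
                  (iterate_run_le_of_le 1 (indicator_one_le_one _) n _)
                split_ifs
                · exact M.minReach_nonneg E c
                · exact le_rfl
          _ = M.minReach E c := by simp
      · exact absurd hc (minEffect_enabled_some.1 hen).1
    calc _ ≤ ∑ α, (M.minEffect E C eff noeff).prob 𝔖 π α * M.minReach E c :=
          Finset.sum_le_sum fun α _ => hα α
      _ = M.minReach E c := by rw [← Finset.sum_mul, sum_prob hterm, one_mul]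

theorem exists_minEffect_actProb (σ : (s : S) → ¬ M.IsTerminal s → PMF (M.EnabledAct s))
    (x : Option S) (hx : ¬ (M.minEffect E C eff noeff).IsTerminal x) :
    ∃ p : PMF ((M.minEffect E C eff noeff).EnabledAct x), ∀ s (hs : ¬ M.IsTerminal s), x = some s →
      s ∉ C → ∀ α, (M.minEffect E C eff noeff).actProb p (some α) = M.actProb (σ s hs) α := by
  rcases x with _ | s
  · exact absurd minEffect_isTerminal_none hx
  · by_cases hs : s ∈ C
    · refine ⟨PMF.pure ⟨none, minEffect_enabled_none.2 hs⟩, fun s' _ h hs' => ?_⟩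
      exact absurd (Option.some_injective _ h ▸ hs) hs'
    · have hterm : ¬ M.IsTerminal s := fun h => hx (minEffect_isTerminal_some.2 ⟨hs, h⟩)
      obtain ⟨p, hp⟩ := (M.minEffect E C eff noeff).exists_actProb_eq (s := some s)
        (w := fun α => α.elim 0 (M.actProb (σ s hterm)))
        (fun α => by
          rcases α with _ | α
          · exact le_rfl
          · exact M.actProb_nonneg _ α)
        (by simpa [Fintype.sum_option] using M.sum_actProb (σ s hterm))
        (fun α hα => by
          rcases α with _ | α
          · exact absurd rfl hα
          · exact minEffect_enabled_some.2 ⟨hs, M.enabled_of_actProb_ne_zero hα⟩)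
      refine ⟨p, fun s' hs' h _ α => ?_⟩
      obtain rfl := Option.some_injective _ h
      rw [hp]
      rfl

/-- The two MDPs differ only from `C` onwards, which the stopped chain never sees, so the limits
found for `M` apply verbatim. -/
theorem stopMatrix_minEffect {σ : (s : S) → ¬ M.IsTerminal s → PMF (M.EnabledAct s)}
    {σ' : (x : Option S) → ¬ (M.minEffect E C eff noeff).IsTerminal x →
      PMF ((M.minEffect E C eff noeff).EnabledAct x)}
    (hσ' : ∀ x hx s (hs : ¬ M.IsTerminal s), x = some s → s ∉ C →
      ∀ α, (M.minEffect E C eff noeff).actProb (σ' x hx) (some α) = M.actProb (σ s hs) α)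
    (t s : S) :
    (M.minEffect E C eff noeff).stopMatrix (some '' (C ∪ E)) σ' (some t) (some s)
      = M.stopMatrix (C ∪ E) σ t s := by
  classical
  unfold stopMatrix
  by_cases ht : t ∈ C ∪ E
  · rw [if_pos (Set.mem_image_of_mem some ht), if_pos ht]
    simp [Pi.single_apply]
  · have ht' : some t ∉ some '' (C ∪ E) := fun h => ht ((Option.some_injective _).mem_set_image.1 h)
    have htC : t ∉ C := fun h => ht (Or.inl h)
    rw [if_neg ht', if_neg ht]
    by_cases hterm : M.IsTerminal t
    · rw [dif_pos (minEffect_isTerminal_some.2 ⟨htC, hterm⟩), dif_pos hterm]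
      simp [Pi.single_apply]
    · have hterm' : ¬ (M.minEffect E C eff noeff).IsTerminal (some t) := fun h =>
        hterm (minEffect_isTerminal_some.1 h).2
      rw [dif_neg hterm', dif_neg hterm, Fintype.sum_option]
      have h0 : (M.minEffect E C eff noeff).actProb (σ' (some t) hterm') none = 0 := by
        by_contra h
        exact htC (minEffect_enabled_none.1 (enabled_of_actProb_ne_zero _ h))
      rw [h0, zero_mul, zero_add]
      refine Finset.sum_congr rfl fun α _ => ?_
      rw [hσ' _ _ t hterm rfl htC, minEffect_P_some htC]

theorem exists_memoryless_refutesGPR (hE : ∀ s ∈ E, M.IsTerminal s) (hCE : Disjoint C E)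
    (hnoeff : ∀ t, noeff = some t → M.IsTerminal t ∧ t ∉ E ∧ t ∉ C) {β : S → ℝ}
    (hβ : Refuting (C.indicator 1) (E.indicator 1) (C.indicator (M.minReach E)) β)
    {σ : (s : S) → ¬ M.IsTerminal s → PMF (M.EnabledAct s)}
    (hσ : ∀ a : ℕ → S → ℝ, (∀ s, a 0 s = open Classical in (Pi.single M.init 1 : S → ℝ) s) →
      (∀ n s, a (n + 1) s = ∑ t, a n t * M.stopMatrix (C ∪ E) σ t s) →
      ∀ c ∈ C ∪ E, Filter.Tendsto (fun n => a n c) Filter.atTop (nhds (β c))) :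
    ∃ 𝔖 : (M.minEffect E C eff noeff).Scheduler, 𝔖.IsMemoryless ∧
      (M.minEffect E C eff noeff).RefutesGPR (some '' E) (some '' C) 𝔖 := by
  classical
  choose σ' hσ' using exists_minEffect_actProb (E := E) (C := C) (eff := eff) (noeff := noeff) σ
  set 𝔖 : (M.minEffect E C eff noeff).Scheduler := ⟨fun π h => σ' π.last h⟩ with h𝔖
  set a := (M.minEffect E C eff noeff).stateProb 𝔖 (some '' C ∪ some '' E)
    (M.minEffect E C eff noeff).init with ha
  have hsucc := stateProb_succ (M := M.minEffect E C eff noeff) (𝔖 := 𝔖)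
    (T := some '' (C ∪ E)) (σ := σ') (fun π _ _ hs => rfl) (M.minEffect E C eff noeff).init
  rw [Set.image_union] at hsucc
  have hlim := hσ (fun n s => a n (some s)) (fun s => by
      rw [ha, stateProb_zero]
      have hinit : (M.minEffect E C eff noeff).init = some M.init := rfl
      simp [Pi.single_apply, hinit])
    (fun n s => by
      rw [ha, hsucc, Fintype.sum_option, ← Set.image_union]
      have h0 : (M.minEffect E C eff noeff).stopMatrix (some '' (C ∪ E)) σ' none (some s) = 0 := by
        rw [stopMatrix, if_neg (by simp), dif_pos minEffect_isTerminal_none]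
        simp
      rw [h0, mul_zero, zero_add]
      exact Finset.sum_congr rfl fun t _ => congrArg _ (stopMatrix_minEffect hσ' t s))
  have hdot : ∀ (U : Set S) (r : S → ℝ) (n : ℕ),
      (some '' U).indicator (fun x : Option S => x.elim 0 r) ⬝ᵥ a n
        = U.indicator r ⬝ᵥ fun s => a n (some s) := by
    intro U r n
    rw [dotProduct, Fintype.sum_option]
    have h1 : ∀ s, (some '' U).indicator (fun x : Option S => x.elim 0 r) (some s)
        = U.indicator r s := fun s => by
      by_cases hs : s ∈ U <;> simp [hs]
    simp [h1, dotProduct]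
  have hdot1 : ∀ (U : Set S) (n : ℕ),
      (some '' U).indicator 1 ⬝ᵥ a n = U.indicator 1 ⬝ᵥ fun s => a n (some s) := by
    intro U n
    rw [← hdot U 1 n]
    congr 1
    ext x
    rcases x with _ | s
    · simp
    · by_cases hs : s ∈ U <;> simp [hs]
  have hsupp : ∀ (U : Set S) (r : S → ℝ), U ⊆ C ∪ E → ∀ s ∉ C ∪ E, U.indicator r s = 0 :=
    fun U r hU s hs => Set.indicator_of_notMem (fun h => hs (hU h)) r
  refine ⟨𝔖, ⟨σ', fun π h => rfl⟩, refutesGPR_of_tendsto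
    (m := fun x : Option S => x.elim 0 (M.minReach E)) ?_ ?_ ?_ ?_ ?_ ?_ hβ.1 hβ.2⟩
  · rintro _ ⟨e, he, rfl⟩
    exact minEffect_isTerminal_some.2 ⟨fun h => Set.disjoint_left.1 hCE h he, hE e he⟩
  · exact (Set.disjoint_image_iff (Option.some_injective _)).2 hCE
  · rintro π hπ ⟨c, hc, hlast⟩ n
    rw [← hlast]
    exact minEffect_run_le hCE hnoeff 𝔖 hπ hc hlast.symm n
  · simp only [← ha, hdot1]
    exact tendsto_dotProduct_of_support (hsupp C _ Set.subset_union_left) hlim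
  · simp only [← ha, hdot1]
    exact tendsto_dotProduct_of_support (hsupp E _ Set.subset_union_right) hlim
  · simp only [← ha, hdot]
    exact tendsto_dotProduct_of_support (hsupp C _ Set.subset_union_left) hlim

end minEffect

end MDP

theorem mainTheorem4 {S Act : Type*} [Fintype S] [Fintype Act] (M : MDP S Act)
    (Eff Cause : Set S)
    (hEff : Eff.Nonempty) (hEffTerminal : ∀ e ∈ Eff, M.IsTerminal e) (hEffInit : M.init ∉ Eff)
    (hCause : Cause.Nonempty) (hDisjoint : Disjoint Cause Eff)
    (hMinimality : M.Minimality Cause)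
    (hNotGPR : ¬ M.IsGPRCause Eff Cause)
    (eff : S) (heff : eff ∈ Eff)
    (noeff : Option S)
    (hnoeff : ∀ t, noeff = some t → M.IsTerminal t ∧ t ∉ Eff ∧ t ∉ Cause) :
    (∃ 𝔖 : (M.minEffect Eff Cause eff noeff).Scheduler, 𝔖.IsMemoryless ∧
      (M.minEffect Eff Cause eff noeff).RefutesGPR (some '' Eff) (some '' Cause) 𝔖) ∧
    (∃ 𝔗 : M.Scheduler, 𝔗.HasMemory 2 ∧ M.RefutesGPR Eff Cause 𝔗) := by
  classical
  obtain ⟨𝔖, hpos, hraise⟩ : ∃ 𝔖 : M.Scheduler,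
      0 < M.Pr 𝔖 M.init (eventually Act Cause) ∧ ¬ M.Raises Eff Cause 𝔖 := by
    by_contra! hcon
    exact hNotGPR ⟨hCause, hDisjoint, hMinimality, hcon⟩
  obtain ⟨y₀, β₀, hβ₀⟩ := MDP.exists_balance_of_refutesGPR hEffTerminal hDisjoint ⟨hpos, hraise⟩
  obtain ⟨Z, y, β, hZ, hbal, href, hzero⟩ := M.exists_refuting_balance (T := Cause ∪ Eff)
    (Set.indicator_nonneg fun _ _ => zero_le_one) (Set.indicator_nonneg fun _ _ => zero_le_one)
    (Set.indicator_nonneg fun s _ => M.minReach_nonneg Eff s)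
    (fun s => Set.indicator_le_indicator (M.minReach_le_one Eff s))
    (fun s hs => Set.indicator_of_notMem (fun h => hs (Or.inl h)) _)
    (fun s hs => Set.indicator_of_notMem (fun h => hs (Or.inr h)) _) ⟨y₀, β₀, hβ₀⟩
  obtain ⟨σ, hσ⟩ := hbal.exists_memoryless hZ hzero
  have hσ' := fun a h0 => hσ a (funext h0)
  exact ⟨MDP.exists_memoryless_refutesGPR hEffTerminal hDisjoint hnoeff href hσ',
    M.exists_two_memory_refutesGPR hEffTerminal hDisjoint href hσ'⟩
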